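/- **Theorem 4.** Setting. Let $\Theta_0$ be a compact metric space (for instance a compact subset of $\mathbb{R}^p$), let $k\ge 0$, let $\Sigma:\Theta_0\times\Theta_0\to\mathbb{R}^{k\times k}$ be a continuous covariance function such that the centered Gaussian process $\mathcal{GP}(0,\Sigma)$ has a version with continuous paths, and let $\theta_0\in\Theta_0$ be such that $\Sigma(\theta,\theta_0)$ is nonsingular for every $\theta\in\Theta_0$. Put $$\psi(\theta)=\Sigma(\theta,\theta_0)\Sigma(\theta_0,\theta_0)^{-1},\qquad \widetilde\Sigma(\theta_1,\theta_2)=\Sigma(\theta_1,\theta_2)-\Sigma(\theta_1,\theta_0)\Sigma(\theta_0,\theta_0)^{-1}\Sigma(\theta_0,\theta_2),$$ and let $\mathcal{H}_\mu$ be the reproducing kernel Hilbert space of functions $\Theta_0\to\mathbb{R}^k$ generated by $\widetilde\Sigma$. For $\theta\in\Theta_0$ and a continuous function $\mu:\Theta_0\to\mathbb{R}^k$, in particular for $\mu\in\mathcal{H}_\mu$, let $\mathbb{E}_{\theta,\mu}$ be the expectation when the observed continuous process is $g\sim\mathcal{GP}(m,\Sigma)$ with mean $m(\cdot)=\mu(\cdot)-\psi(\cdot)\psi(\theta)^{-1}\mu(\theta)$.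 Let $\xi=g(\theta_0)$ and $h(\cdot)=g(\cdot)-\psi(\cdot)\xi$, and let $\ell(\mu,\theta;\xi)$ be the density of $N\big(-\psi(\theta)^{-1}\mu(\theta),\Sigma(\theta_0,\theta_0)\big)$ at $\xi$. Let $\pi(\theta)$ be a probability measure on $\Theta_0$ and let $\pi(\mu)$ be a Borel probability measure on $C(\Theta_0;\mathbb{R}^k)$ that is concentrated on the parameter space $\mathcal{H}_\mu$. Let $\pi(\mu\mid h)$ be the posterior (conditional distribution) of $\mu$ given $h$ under the prior $\pi(\theta,\mu)=\pi(\theta)\pi(\mu)$, and let $$\ell^*(\theta)=\int\ell(\mu,\theta;\xi)\,d\pi(\mu\mid h),\qquad T=\frac{\int\ell^*(\theta)\,d\pi(\theta)}{\ell^*(\theta_0)} .$$ Let $\alpha\in(0,1)$ and let $c_\alpha(h)$ be the $1-\alpha$ quantile of the conditional distribution of $T$ given $h$ under $\theta_0$ (this conditional distribution is, up to null sets, the same for all $\mu\in\mathcal{H}_\mu$, so it may be computed at any fixed $\mu_0\in\mathcal{H}_\mu$). A (possibly randomized) test is a measurable function $\varphi$ of $g$ with values in $[0,1]$; it is similar if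 $\mathbb{E}_{\theta_0,\mu}[\varphi]=\alpha$ for all $\mu\in\mathcal{H}_\mu$. Claim. Suppose that, under $\theta_0$, for almost every $h$ the conditional distribution of $T$ given $h$ is continuous (has no atoms). Then the test $\varphi^*=\mathbb{1}\{T>c_\alpha(h)\}$ is similar. Further, $\varphi^*$ maximizes $\pi(\theta)\pi(\mu)$-weighted average power over the class of similar tests: for every similar test $\varphi$, the function $(\theta,\mu)\mapsto\mathbb{E}_{\theta,\mu}[\varphi^*-\varphi]$ is $\pi(\theta)\pi(\mu)$-integrable and $$\int\mathbb{E}_{\theta,\mu}[\varphi^*-\varphi]\,d\pi(\theta)\,d\pi(\mu)\ \ge\ 0 .$$ -/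

import Mathlib

open MeasureTheory ProbabilityTheory Set Filter Topology
open scoped ENNReal Matrix

noncomputable section

namespace WeakGMM

/-- The values of the moment function: `ℝᵏ` with its Euclidean structure. -/
abbrev Vec (k : ℕ) := EuclideanSpace ℝ (Fin k)

/-- The space `C(Θ₀; ℝᵏ)` of continuous sample paths. -/
abbrev Path (Θ : Type*) [TopologicalSpace Θ] (k : ℕ) := C(Θ, Vec k)

/-- Paths carry the Borel σ-algebra of the topology of uniform convergence. -/
instance instMeasurableSpacePath (Θ : Type*) [TopologicalSpace Θ] (k : ℕ) :
    MeasurableSpace (Path Θ k) := borel _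

instance instBorelSpacePath (Θ : Type*) [TopologicalSpace Θ] (k : ℕ) :
    BorelSpace (Path Θ k) := ⟨rfl⟩

/-- A continuous matrix-valued function of two parameters, `(θ₁, θ₂) ↦ Σ(θ₁, θ₂) ∈ ℝᵏˣᵏ`. -/
abbrev CovFun (Θ : Type*) [TopologicalSpace Θ] (k : ℕ) := C(Θ × Θ, Matrix (Fin k) (Fin k) ℝ)

/-- The operator on `ℝᵏ` given by a matrix. -/
abbrev op {k : ℕ} (M : Matrix (Fin k) (Fin k) ℝ) : Vec k →L[ℝ] Vec k :=
  Matrix.toEuclideanCLM (n := Fin k) (𝕜 := ℝ) M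

lemma continuous_op_apply {X : Type*} [TopologicalSpace X] {k : ℕ}
    {M : X → Matrix (Fin k) (Fin k) ℝ} (hM : Continuous M) (v : Vec k) :
    Continuous fun x => op (M x) v :=
  (PiLp.continuous_toLp 2 _).comp (hM.matrix_mulVec continuous_const)

section Model

variable {Θ : Type*} [TopologicalSpace Θ] {k : ℕ}

/-- `P` is the law on path space of the Gaussian process `GP(m, Σ)`. -/
structure IsGPLaw (P : Measure (Path Θ k)) (m : Path Θ k) (Sig : CovFun Θ k) : Prop where
  gaussian : IsGaussianProcess (fun (θ : Θ) (g : Path Θ k) => g θ) P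
  mean : ∀ θ : Θ, ∫ g, g θ ∂P = m θ
  covariance : ∀ (θ₁ θ₂ : Θ) (i j : Fin k),
    cov[fun g : Path Θ k => g θ₁ i, fun g : Path Θ k => g θ₂ j; P] = Sig (θ₁, θ₂) i j

variable (Sig : CovFun Θ k) (θ₀ : Θ)

/-- `ψ(θ) = Σ(θ, θ₀) Σ(θ₀, θ₀)⁻¹`, the regression coefficient of `g(θ)` on `ξ = g(θ₀)`. -/
def psi (θ : Θ) : Matrix (Fin k) (Fin k) ℝ := Sig (θ, θ₀) * (Sig (θ₀, θ₀))⁻¹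

lemma continuous_psi : Continuous (psi Sig θ₀) :=
  (Sig.continuous.comp (by fun_prop : Continuous fun θ : Θ => (θ, θ₀))).matrix_mul
    continuous_const

/-- The statistic `h(·) = g(·) - Σ(·, θ₀) Σ(θ₀, θ₀)⁻¹ g(θ₀)`. -/
def hPart (g : Path Θ k) : Path Θ k where
  toFun t := g t - op (psi Sig θ₀ t) (g θ₀)
  continuous_toFun := g.continuous.sub (continuous_op_apply (continuous_psi Sig θ₀) _)

/-- `Σ̃(θ₁, θ₂) = Σ(θ₁, θ₂) - Σ(θ₁, θ₀) Σ(θ₀, θ₀)⁻¹ Σ(θ₀, θ₂)`, the covariance function of `h`. -/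
def covTilde (θ₁ θ₂ : Θ) : Matrix (Fin k) (Fin k) ℝ :=
  Sig (θ₁, θ₂) - Sig (θ₁, θ₀) * (Sig (θ₀, θ₀))⁻¹ * Sig (θ₀, θ₂)

/-- `Σ̃` as an operator-valued kernel. -/
def kernelTilde : Matrix Θ Θ (Vec k →L[ℝ] Vec k) :=
  Matrix.of fun θ₁ θ₂ => op (covTilde Sig θ₀ θ₁ θ₂)

/-- `H_μ`, the reproducing kernel Hilbert space generated by `Σ̃`, as a set of functions on `Θ₀`.
(The kernel `Σ̃` is positive semidefinite as soon as `Σ` is a covariance function.) -/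
def nuisanceSpace : Set (Path Θ k) :=
  {μ | ∃ hK : (kernelTilde Sig θ₀).PosSemidef,
    haveI : Fact (kernelTilde Sig θ₀).PosSemidef := ⟨hK⟩
    ∃ f : RKHS.OfKernel (kernelTilde Sig θ₀), ∀ θ : Θ, f θ = μ θ}

/-- The mean function `m = μ - ψ(·) ψ(θ)⁻¹ μ(θ)` with parameters `(θ, μ)`; it vanishes at `θ`. -/
def meanFun (θ : Θ) (μ : Path Θ k) : Path Θ k where
  toFun t := μ t - op (psi Sig θ₀ t) (op (psi Sig θ₀ θ)⁻¹ (μ θ))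
  continuous_toFun := μ.continuous.sub (continuous_op_apply (continuous_psi Sig θ₀) _)

/-- The law of the observation `g` under `(θ, μ)`. If `P₀` is the law of `GP(0, Σ)`, this is the
law of `GP(m, Σ)` for the mean function `m` with parameters `(θ, μ)`. -/
def gLaw (P₀ : Measure (Path Θ k)) (θ : Θ) (μ : Path Θ k) : Measure (Path Θ k) :=
  P₀.map fun G => G + meanFun Sig θ₀ θ μ

/-- The Lebesgue density at `x` of the normal law `N(ν, S)` on `ℝᵏ`. -/
def normalDensity (ν : Vec k) (S : Matrix (Fin k) (Fin k) ℝ) (x : Vec k) : ℝ :=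
  (√((2 * Real.pi) ^ k * S.det))⁻¹ * Real.exp (-(1 / 2) * inner ℝ (x - ν) (op S⁻¹ (x - ν)))

/-- The likelihood `ℓ(μ, θ; ξ)` of `ξ = g(θ₀) ~ N(-ψ(θ)⁻¹ μ(θ), Σ(θ₀, θ₀))`. -/
def lik (μ : Path Θ k) (θ : Θ) (ξ : Vec k) : ℝ :=
  normalDensity (-(op (psi Sig θ₀ θ)⁻¹ (μ θ))) (Sig (θ₀, θ₀)) ξ

end Model

section Bayes

variable {Θ : Type*} [MetricSpace Θ] [CompactSpace Θ] [MeasurableSpace Θ] {k : ℕ}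
  (Sig : CovFun Θ k) (θ₀ : Θ) (P₀ : Measure (Path Θ k)) [IsProbabilityMeasure P₀]
  (πθ : Measure Θ) [IsProbabilityMeasure πθ] (πμ : Measure (Path Θ k)) [IsProbabilityMeasure πμ]

/-- The joint law of `((θ, μ), g)` when `θ ~ π(θ)` and `μ ~ π(μ)` are independent and, given
`(θ, μ)`, the observation `g` has the law with parameters `(θ, μ)`. -/
def jointLaw : Measure ((Θ × Path Θ k) × Path Θ k) :=
  ((πθ.prod πμ).prod P₀).map fun z => (z.1, z.2 + meanFun Sig θ₀ z.1.1 z.1.2)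

instance : IsFiniteMeasure (jointLaw Sig θ₀ P₀ πθ πμ) := by
  unfold jointLaw; infer_instance

/-- The posterior `π(μ | h)`: the conditional distribution of `μ` given `h`. -/
def posteriorNuisance : Kernel (Path Θ k) (Path Θ k) :=
  condDistrib (fun z : (Θ × Path Θ k) × Path Θ k => z.1.2) (fun z => hPart Sig θ₀ z.2)
    (jointLaw Sig θ₀ P₀ πθ πμ)

/-- The integrated likelihood `ℓ*(θ) = ∫ ℓ(μ, θ; ξ) dπ(μ | h)`, as a function of the data `g`. -/
def ellStar (θ : Θ) (g : Path Θ k) : ℝ :=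
  ∫ μ, lik Sig θ₀ μ θ (g θ₀) ∂(posteriorNuisance Sig θ₀ P₀ πθ πμ (hPart Sig θ₀ g))

/-- The test statistic `T = ∫ ℓ*(θ) dπ(θ) / ℓ*(θ₀)`. -/
def stat (g : Path Θ k) : ℝ :=
  (∫ θ, ellStar Sig θ₀ P₀ πθ πμ θ g ∂πθ) / ellStar Sig θ₀ P₀ πθ πμ θ₀ g

instance (θ : Θ) (μ : Path Θ k) : IsFiniteMeasure (gLaw Sig θ₀ P₀ θ μ) := by
  unfold gLaw; infer_instance

/-- The conditional distribution of `T` given `h` under `(θ₀, μ₀)`. Up to null sets it does not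
depend on `μ₀` in the nuisance space, because under `θ₀` the vector `ξ ~ N(0, Σ(θ₀, θ₀))` is
independent of `h`. -/
def condLawStat (μ₀ : Path Θ k) : Kernel (Path Θ k) ℝ :=
  condDistrib (stat Sig θ₀ P₀ πθ πμ) (hPart Sig θ₀) (gLaw Sig θ₀ P₀ θ₀ μ₀)

/-- The `q`-quantile `inf {x | ν(-∞, x] ≥ q}` of a law `ν` on the line. -/
def quantile (ν : Measure ℝ) (q : ℝ) : ℝ := sInf {x : ℝ | q ≤ ν.real (Iic x)}

/-- The conditional critical value `c_α(h)`. -/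
def critVal (μ₀ : Path Θ k) (α : ℝ) (h : Path Θ k) : ℝ :=
  quantile (condLawStat Sig θ₀ P₀ πθ πμ μ₀ h) (1 - α)

open Classical in
/-- The test `φ* = 1{T > c_α(h)}`. -/
def optTest (μ₀ : Path Θ k) (α : ℝ) (g : Path Θ k) : ℝ :=
  if stat Sig θ₀ P₀ πθ πμ g > critVal Sig θ₀ P₀ πθ πμ μ₀ α (hPart Sig θ₀ g) then 1 else 0

/-- `φ` is a (possibly randomized) test of `θ* = θ₀`, given by its conditional rejection
probability, with rejection probability `α` under `θ₀` for every value of the nuisance `μ`. -/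
structure IsSimilarTest (α : ℝ) (φ : Path Θ k → ℝ) : Prop where
  measurable : Measurable φ
  mem_Icc : ∀ g, φ g ∈ Icc (0 : ℝ) 1
  similar : ∀ μ ∈ nuisanceSpace Sig θ₀, ∫ g, φ g ∂(gLaw Sig θ₀ P₀ θ₀ μ) = α

end Bayes

end WeakGMM

end

/-! Split the observation as g = h + ψ(·)ξ. Under GP(0, Σ) the path h and the vector ξ are
independent, because h is the residual of the regression on ξ. Adding multiples of ψ leaves h
unchanged, so the law of h depends on μ alone. Every μ in the nuisance space vanishes at θ₀, so
under θ₀ the shift moves only h, and ξ keeps the law N(0, Σ(θ₀, θ₀)).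

Under the null, h is therefore sufficient for μ. It is also complete. Shifts of h by finite
combinations of the kernel functions Σ̃(·, θ)v have Cameron–Martin densities proportional to
exponentials of linear statistics of h. If F(h) has the same mean under all these shifts, the
exponential moments determine the measure F d(law of h), and F is almost surely constant
(`IsGPLaw.ae_eq_of_lintegral_add_kerPath`). Hence a similar test has conditional size α given h, for
almost every h.

For the average power, the posterior kernel disintegrates the joint law of (h, μ), and the effect of
θ on ξ is a change of measure by a Gaussian likelihood ratio. The average power becomes ∫∫ φ(h + ψx)
W(h, x) dN(x) d(law of h), with W the integrated likelihood ratio and N the null law of ξ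
(`IsGPLaw.lintegral_gLaw_eq`). The statistic T equals W, since the N(0, Σ(θ₀, θ₀)) density cancels
and the ratio is 1 at θ₀ (`IsGPLaw.stat_eq`). For fixed h this is a Neyman–Pearson problem: among
tests of conditional size α, rejecting for large W is best. Atomlessness makes the quantile cutoff
have size exactly α. The laws of g under (θ₀, μ), for μ in the nuisance space, are mutually
absolutely continuous, so a critical value computed at one μ₀ serves them all.

Identities between measures on path space are reduced to exponential moments of finite linear
statistics. For the centered process these are explicit, because the L² closure of the linear
statistics consists of Gaussian variables. -/

noncomputable section

set_option linter.unusedSectionVars false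

namespace WeakGMM

/-! ### Finite linear statistics of paths -/

section PathSpace

variable {Θ : Type*} [TopologicalSpace Θ] {k : ℕ}

/-- The pairing `(g, w) ↦ ∑ ⟨g θ, w θ⟩` of paths with finitely supported weights. -/
def ev : Path Θ k →ₗ[ℝ] (Θ →₀ Vec k) →ₗ[ℝ] ℝ where
  toFun g := Finsupp.lsum ℝ fun θ => innerₗ (Vec k) (g θ)
  map_add' g g' := by
    ext; simp
  map_smul' c g := by
    ext; simp

lemma ev_apply (g : Path Θ k) (w : Θ →₀ Vec k) :
    ev g w = w.sum fun θ v => inner ℝ (g θ) v := rfl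

@[simp] lemma ev_single (g : Path Θ k) (θ : Θ) (v : Vec k) :
    ev g (Finsupp.single θ v) = inner ℝ (g θ) v := by
  simp [ev]

lemma continuous_ev (w : Θ →₀ Vec k) : Continuous fun g : Path Θ k => ev g w := by
  simp only [ev_apply, Finsupp.sum]
  exact continuous_finsetSum _ fun θ _ =>
    (continuous_eval_const θ).inner continuous_const

lemma measurable_ev (w : Θ →₀ Vec k) : Measurable fun g : Path Θ k => ev g w :=
  (continuous_ev w).measurable

end PathSpace

/-! ### Exponential moments determine finite measures on path space -/

section Ext

variable {Θ : Type*} [MetricSpace Θ] [CompactSpace Θ] {k : ℕ}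

/-- Finite measures on path space are determined by the exponential moments of their
finite-dimensional linear statistics. -/
theorem measure_ext_of_mgf {ν₁ ν₂ : Measure (Path Θ k)} [IsFiniteMeasure ν₁] [IsFiniteMeasure ν₂]
    (hint : ∀ w, Integrable (fun g : Path Θ k => Real.exp (ev g w)) ν₁)
    (h : ∀ w, ∫ g, Real.exp (ev g w) ∂ν₁ = ∫ g, Real.exp (ev g w) ∂ν₂) : ν₁ = ν₂ := by
  -- The extensionality theorem asks for a jointly continuous pairing. With discrete weights this
  -- reduces to continuity in the path.
  let _ : TopologicalSpace (Θ →₀ Vec k) := ⊥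
  have : DiscreteTopology (Θ →₀ Vec k) := ⟨rfl⟩
  have hcont : Continuous fun p : Path Θ k × (Θ →₀ Vec k) => ev p.1 p.2 :=
    continuous_prod_of_discrete_right.2 continuous_ev
  refine ext_of_integral_char_eq (L := ev) Real.continuous_probChar Real.probChar_ne_one ?_ hcont ?_
  · intro g hg h0
    apply hg
    ext1 θ
    have := congrArg (fun l => l (Finsupp.single θ (g θ))) h0
    simpa using this
  · intro w
    -- Scaling the weight w by t turns the hypothesis at all weights into equality of whole moment
    -- generating functions. These are finite everywhere, so they continue analytically to the
    -- imaginary unit, where they give the characters.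
    have hmgf : mgf (fun g : Path Θ k => ev g w) ν₁ = mgf (fun g : Path Θ k => ev g w) ν₂ := by
      ext t
      have := h (t • w)
      simpa [mgf] using this
    have hset : integrableExpSet (fun g : Path Θ k => ev g w) ν₁ = univ := by
      ext t
      have := hint (t • w)
      simpa [integrableExpSet] using this
    have hzero : ν₁ = 0 ↔ ν₂ = 0 := by
      have := h 0
      simp only [map_zero, Real.exp_zero, integral_const, smul_eq_mul, mul_one] at this
      rw [← Measure.measure_univ_eq_zero, ← Measure.measure_univ_eq_zero,
        ← measureReal_eq_zero_iff, ← measureReal_eq_zero_iff, this]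
    have key := eqOn_complexMGF_of_mgf' hmgf hzero (x := Complex.I) (by simp [hset])
    simpa [complexMGF, BoundedContinuousFunction.char_apply, Real.probChar_apply,
      mul_comm] using key

end Ext

/-! ### The Gaussian Hilbert space and the Cameron–Martin formula -/

section GaussianSpace

variable {Θ : Type*} [MetricSpace Θ] [CompactSpace Θ] {k : ℕ} {Sig : CovFun Θ k}
  {P₀ : Measure (Path Θ k)} [IsProbabilityMeasure P₀]

lemma IsGPLaw.hasGaussianLaw_ev (hP : IsGPLaw P₀ 0 Sig) (w : Θ →₀ Vec k) :
    HasGaussianLaw (fun g : Path Θ k => ev g w) P₀ := by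
  have h := (hP.gaussian.hasGaussianLaw w.support).map
    (∑ i : w.support, (innerSL ℝ (w i)).comp (ContinuousLinearMap.proj (R := ℝ)
      (φ := fun _ : w.support => Vec k) i))
  convert! h using 1
  ext g
  simp only [ev_apply, Finsupp.sum, Function.comp_apply, _root_.sum_apply,
    ContinuousLinearMap.comp_apply, ContinuousLinearMap.proj_apply, innerSL_apply_apply,
    Finset.restrict]
  rw [← Finset.sum_coe_sort]
  exact Finset.sum_congr rfl fun i _ => real_inner_comm _ _

/-- The embedding of linear statistics of a Gaussian process into `L²`. -/
def IsGPLaw.toL2 (hP : IsGPLaw P₀ 0 Sig) : (Θ →₀ Vec k) →ₗ[ℝ] Lp ℝ 2 P₀ where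
  toFun w := (hP.hasGaussianLaw_ev w).memLp_two.toLp
  map_add' w w' := by
    rw [← MemLp.toLp_add]
    exact MemLp.toLp_congr _ _ (ae_of_all _ fun g => by simp)
  map_smul' c w := by
    rw [RingHom.id_apply, ← MemLp.toLp_const_smul]
    exact MemLp.toLp_congr _ _ (ae_of_all _ fun g => by simp)

lemma IsGPLaw.coeFn_toL2 (hP : IsGPLaw P₀ 0 Sig) (w : Θ →₀ Vec k) :
    hP.toL2 w =ᵐ[P₀] fun g => ev g w :=
  (hP.hasGaussianLaw_ev w).memLp_two.coeFn_toLp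

lemma IsGPLaw.inner_toL2 (hP : IsGPLaw P₀ 0 Sig) (w w' : Θ →₀ Vec k) :
    inner ℝ (hP.toL2 w) (hP.toL2 w') = ∫ g, ev g w * ev g w' ∂P₀ := by
  rw [L2.inner_def]
  refine integral_congr_ae ?_
  filter_upwards [hP.coeFn_toL2 w, hP.coeFn_toL2 w'] with g h h'
  simp [h, h', mul_comm]

lemma IsGPLaw.integral_coord (hP : IsGPLaw P₀ 0 Sig) (θ : Θ) (i : Fin k) :
    ∫ g, g θ i ∂P₀ = 0 := by
  have hint : Integrable (fun g : Path Θ k => g θ) P₀ :=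
    (hP.gaussian.hasGaussianLaw_eval θ).integrable
  have := (EuclideanSpace.proj (𝕜 := ℝ) i).integral_comp_comm hint
  rw [hP.mean] at this
  simpa using this

lemma IsGPLaw.memLp_coord (hP : IsGPLaw P₀ 0 Sig) (θ : Θ) (i : Fin k) :
    MemLp (fun g : Path Θ k => g θ i) 2 P₀ :=
  ((hP.gaussian.hasGaussianLaw_eval θ).map (EuclideanSpace.proj (𝕜 := ℝ) i)).memLp_two

lemma IsGPLaw.integral_coord_mul (hP : IsGPLaw P₀ 0 Sig) (θ θ' : Θ) (i j : Fin k) :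
    ∫ g, g θ i * g θ' j ∂P₀ = Sig (θ, θ') i j := by
  have := hP.covariance θ θ' i j
  rw [covariance_eq_sub (hP.memLp_coord θ i) (hP.memLp_coord θ' j)] at this
  simpa [hP.integral_coord] using this

lemma IsGPLaw.transpose_cov (hP : IsGPLaw P₀ 0 Sig) (θ θ' : Θ) :
    (Sig (θ, θ'))ᵀ = Sig (θ', θ) := by
  ext i j
  rw [Matrix.transpose_apply, ← hP.covariance, ← hP.covariance, covariance_comm]

lemma inner_op_left (M : Matrix (Fin k) (Fin k) ℝ) (v v' : Vec k) :
    inner ℝ (op M v) v' = inner ℝ v (op Mᵀ v') := by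
  simp only [op, PiLp.inner_apply, Matrix.ofLp_toEuclideanCLM, RCLike.inner_apply, conj_trivial,
    Matrix.mulVec, dotProduct, Finset.mul_sum, Finset.sum_mul, Matrix.transpose_apply]
  rw [Finset.sum_comm]
  refine Finset.sum_congr rfl fun i _ => Finset.sum_congr rfl fun j _ => by ring

lemma op_mul_apply (M N : Matrix (Fin k) (Fin k) ℝ) (v : Vec k) :
    op (M * N) v = op M (op N v) := by
  simp [op]

lemma op_one_apply (v : Vec k) : op (1 : Matrix (Fin k) (Fin k) ℝ) v = v := by
  simp [op]

lemma IsGPLaw.inner_toL2_single (hP : IsGPLaw P₀ 0 Sig) (θ θ' : Θ) (v v' : Vec k) :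
    inner ℝ (hP.toL2 (.single θ v)) (hP.toL2 (.single θ' v')) =
      inner ℝ v (op (Sig (θ, θ')) v') := by
  have hint (i j : Fin k) : Integrable (fun g : Path Θ k => g θ i * g θ' j) P₀ :=
    (hP.memLp_coord θ i).integrable_mul (hP.memLp_coord θ' j)
  have h1 : ∀ g : Path Θ k, ev g (.single θ v) * ev g (.single θ' v') =
      ∑ i, ∑ j, v i * v' j * (g θ i * g θ' j) := by
    intro g
    simp only [ev_single, PiLp.inner_apply, RCLike.inner_apply, conj_trivial,
      Finset.sum_mul_sum]
    exact Finset.sum_congr rfl fun i _ => Finset.sum_congr rfl fun j _ => by ring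
  rw [hP.inner_toL2]
  simp_rw [h1]
  rw [integral_finsetSum _ fun i _ => integrable_finsetSum _ fun j _ =>
    (hint i j).const_mul _]
  simp_rw [integral_finsetSum _ fun j _ => (hint _ j).const_mul _, integral_const_mul,
    hP.integral_coord_mul]
  simp only [op, PiLp.inner_apply, Matrix.ofLp_toEuclideanCLM, RCLike.inner_apply, conj_trivial,
    Matrix.mulVec, dotProduct, Finset.sum_mul]
  exact Finset.sum_congr rfl fun i _ => Finset.sum_congr rfl fun j _ => by ring

/-- The Gaussian Hilbert space spanned by the process. -/
def IsGPLaw.gaussianSpace (hP : IsGPLaw P₀ 0 Sig) : Submodule ℝ (Lp ℝ 2 P₀) :=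
  (LinearMap.range hP.toL2).topologicalClosure

lemma IsGPLaw.toL2_mem (hP : IsGPLaw P₀ 0 Sig) (w : Θ →₀ Vec k) :
    hP.toL2 w ∈ hP.gaussianSpace :=
  Submodule.le_topologicalClosure _ ⟨w, rfl⟩

lemma integral_ev (hP : IsGPLaw P₀ 0 Sig) (w : Θ →₀ Vec k) : ∫ g, ev g w ∂P₀ = 0 := by
  have hint (θ : Θ) : Integrable (fun g : Path Θ k => g θ) P₀ :=
    (hP.gaussian.hasGaussianLaw_eval θ).integrable
  simp only [ev_apply, Finsupp.sum]
  rw [integral_finsetSum _ fun θ _ => (hint θ).inner_const _]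
  refine Finset.sum_eq_zero fun θ _ => ?_
  have := integral_inner (𝕜 := ℝ) (hint θ) (w θ)
  simp_rw [real_inner_comm (w θ)]
  rw [this, hP.mean]
  simp

lemma IsGPLaw.map_toL2 (hP : IsGPLaw P₀ 0 Sig) (w : Θ →₀ Vec k) :
    P₀.map (hP.toL2 w) = gaussianReal 0 (‖hP.toL2 w‖ ^ 2).toNNReal := by
  rw [Measure.map_congr (hP.coeFn_toL2 w), (hP.hasGaussianLaw_ev w).map_eq_gaussianReal,
    integral_ev hP, variance_of_integral_eq_zero (measurable_ev w).aemeasurable (integral_ev hP w),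
    ← real_inner_self_eq_norm_sq, hP.inner_toL2]
  simp [sq]

/-- This rests on |e^{ia} - e^{ib}| ≤ |a - b| together with the bound of the L¹ norm by the L² norm
under a probability measure. It makes the Gaussian condition below closed. -/
lemma lipschitz_charFun_L2 {Ω : Type*} {mΩ : MeasurableSpace Ω} {P : Measure Ω}
    [IsProbabilityMeasure P] (t : ℝ) (X Y : Lp ℝ 2 P) :
    ‖charFun (P.map X) t - charFun (P.map Y) t‖ ≤ |t| * ‖X - Y‖ := by
  have hX : AEMeasurable X P := (Lp.aestronglyMeasurable X).aemeasurable
  have hY : AEMeasurable Y P := (Lp.aestronglyMeasurable Y).aemeasurable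
  have bdd (Z : Lp ℝ 2 P) : Integrable (fun ω => Complex.exp (t * Z ω * Complex.I)) P := by
    refine Integrable.of_bound (C := 1) ?_ (ae_of_all _ fun ω => ?_)
    · have : AEMeasurable Z P := (Lp.aestronglyMeasurable Z).aemeasurable
      exact (by fun_prop : AEMeasurable
        (fun ω => Complex.exp (t * Z ω * Complex.I)) P).aestronglyMeasurable
    · rw [← Complex.ofReal_mul, Complex.norm_exp_ofReal_mul_I]
  rw [charFun_apply_real, charFun_apply_real, integral_map hX (by fun_prop),
    integral_map hY (by fun_prop), ← integral_sub (bdd X) (bdd Y)]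
  have hD : Integrable (X - Y : Lp ℝ 2 P) P :=
    (Lp.memLp (X - Y)).integrable (by norm_num)
  calc ‖∫ ω, Complex.exp (t * X ω * Complex.I) - Complex.exp (t * Y ω * Complex.I) ∂P‖
      ≤ ∫ ω, |t| * ‖(X - Y : Lp ℝ 2 P) ω‖ ∂P := by
        refine norm_integral_le_of_norm_le (hD.norm.const_mul _) ?_
        filter_upwards [Lp.coeFn_sub X Y] with ω hω
        have e1 : Complex.exp (t * X ω * Complex.I) - Complex.exp (t * Y ω * Complex.I) =
            Complex.exp ((t * Y ω : ℝ) * Complex.I) *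
              (Complex.exp (Complex.I * (t * (X ω - Y ω) : ℝ)) - 1) := by
          rw [mul_sub, ← Complex.exp_add, mul_one]
          push_cast
          congr 2
          ring
        rw [e1, norm_mul, Complex.norm_exp_ofReal_mul_I, one_mul, hω, Pi.sub_apply,
          Real.norm_eq_abs, ← abs_mul]
        exact Real.norm_exp_I_mul_ofReal_sub_one_le
    _ = |t| * ∫ ω, ‖(X - Y : Lp ℝ 2 P) ω‖ ∂P := integral_const_mul _ _
    _ ≤ |t| * ‖X - Y‖ := by
        gcongr
        rw [integral_norm_eq_lintegral_enorm hD.1, Lp.norm_def, ← eLpNorm_one_eq_lintegral_enorm]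
        exact ENNReal.toReal_mono (Lp.eLpNorm_ne_top _)
          (eLpNorm_le_eLpNorm_of_exponent_le (by norm_num) (Lp.aestronglyMeasurable _))

/-- Being centered Gaussian with variance ‖X‖² is one equation between characteristic functions for
each t, and both sides are continuous in X. Gaussianity thus passes to L² limits of linear
statistics. -/
lemma isClosed_centeredGaussian {Ω : Type*} {mΩ : MeasurableSpace Ω} {P : Measure Ω}
    [IsProbabilityMeasure P] :
    IsClosed {X : Lp ℝ 2 P | P.map X = gaussianReal 0 (‖X‖ ^ 2).toNNReal} := by
  have hset : {X : Lp ℝ 2 P | P.map X = gaussianReal 0 (‖X‖ ^ 2).toNNReal} =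
      ⋂ t : ℝ, {X : Lp ℝ 2 P |
        charFun (P.map X) t = Complex.exp (-((‖X‖ ^ 2 * t ^ 2 / 2 : ℝ) : ℂ))} := by
    ext X
    have hX : AEMeasurable X P := (Lp.aestronglyMeasurable X).aemeasurable
    have := Measure.isProbabilityMeasure_map hX
    have e (t : ℝ) : charFun (gaussianReal 0 (‖X‖ ^ 2).toNNReal) t =
        Complex.exp (-((‖X‖ ^ 2 * t ^ 2 / 2 : ℝ) : ℂ)) := by
      rw [charFun_gaussianReal]
      simp
    simp only [mem_ofPred_eq, mem_iInter]
    constructor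
    · intro h t
      rw [h, e]
    · intro h
      exact Measure.ext_of_charFun (funext fun t => by rw [h, e])
  rw [hset]
  refine isClosed_iInter fun t => isClosed_eq ?_ (by fun_prop)
  refine (LipschitzWith.of_dist_le_mul (K := ‖t‖₊) fun X Y => ?_).continuous
  rw [dist_eq_norm, dist_eq_norm]
  exact lipschitz_charFun_L2 t X Y

lemma IsGPLaw.map_of_mem (hP : IsGPLaw P₀ 0 Sig) {X : Lp ℝ 2 P₀} (hX : X ∈ hP.gaussianSpace) :
    P₀.map X = gaussianReal 0 (‖X‖ ^ 2).toNNReal := by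
  have : closure (LinearMap.range hP.toL2 : Set (Lp ℝ 2 P₀)) ⊆
      {X : Lp ℝ 2 P₀ | P₀.map X = gaussianReal 0 (‖X‖ ^ 2).toNNReal} := by
    refine closure_minimal ?_ isClosed_centeredGaussian
    rintro _ ⟨w, rfl⟩
    exact hP.map_toL2 w
  exact this hX

lemma IsGPLaw.integrable_exp (hP : IsGPLaw P₀ 0 Sig) {X : Lp ℝ 2 P₀}
    (hX : X ∈ hP.gaussianSpace) : Integrable (fun g => Real.exp (X g)) P₀ := by
  have h := integrable_exp_mul_gaussianReal (μ := 0) (v := (‖X‖ ^ 2).toNNReal) 1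
  rw [← hP.map_of_mem hX] at h
  simpa [Function.comp_def] using h.comp_aemeasurable (Lp.aestronglyMeasurable X).aemeasurable

lemma IsGPLaw.integral_exp (hP : IsGPLaw P₀ 0 Sig) {X : Lp ℝ 2 P₀}
    (hX : X ∈ hP.gaussianSpace) : ∫ g, Real.exp (X g) ∂P₀ = Real.exp (‖X‖ ^ 2 / 2) := by
  have := mgf_gaussianReal (hP.map_of_mem hX) 1
  simpa [mgf] using this

lemma IsGPLaw.integrable_exp_ev (hP : IsGPLaw P₀ 0 Sig) (w : Θ →₀ Vec k) :
    Integrable (fun g => Real.exp (ev g w)) P₀ :=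
  (hP.integrable_exp (hP.toL2_mem w)).congr (by
    filter_upwards [hP.coeFn_toL2 w] with g hg; rw [hg])

lemma IsGPLaw.integral_exp_ev (hP : IsGPLaw P₀ 0 Sig) (w : Θ →₀ Vec k) :
    ∫ g, Real.exp (ev g w) ∂P₀ = Real.exp (‖hP.toL2 w‖ ^ 2 / 2) := by
  rw [← hP.integral_exp (hP.toL2_mem w)]
  refine integral_congr_ae ?_
  filter_upwards [hP.coeFn_toL2 w] with g hg; rw [hg]

lemma measurable_add_path (μ : Path Θ k) : Measurable fun g : Path Θ k => g + μ :=
  (continuous_id.add continuous_const).measurable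

/-- The Cameron–Martin theorem: if `μ` is represented by an element `L` of the Gaussian space, the
shift by `μ` has density `exp (L - ‖L‖² / 2)`. -/
theorem IsGPLaw.map_add_eq_withDensity (hP : IsGPLaw P₀ 0 Sig) {L : Lp ℝ 2 P₀}
    (hL : L ∈ hP.gaussianSpace) {μ : Path Θ k} (hμ : ∀ w, inner ℝ L (hP.toL2 w) = ev μ w) :
    P₀.map (fun g => g + μ) =
      P₀.withDensity fun g => ENNReal.ofReal (Real.exp (L g - ‖L‖ ^ 2 / 2)) := by
  have hLm : AEMeasurable L P₀ := (Lp.aestronglyMeasurable L).aemeasurable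
  have hdm : AEMeasurable (fun g => ENNReal.ofReal (Real.exp (L g - ‖L‖ ^ 2 / 2))) P₀ := by
    fun_prop
  have hdi : Integrable (fun g => Real.exp (L g - ‖L‖ ^ 2 / 2)) P₀ := by
    simp_rw [sub_eq_add_neg, Real.exp_add]
    exact (hP.integrable_exp hL).mul_const _
  have : IsFiniteMeasure
      (P₀.withDensity fun g => ENNReal.ofReal (Real.exp (L g - ‖L‖ ^ 2 / 2))) :=
    isFiniteMeasure_withDensity_ofReal hdi.2
  refine measure_ext_of_mgf (fun w => ?_) fun w => ?_
  · rw [integrable_map_measure (by have := continuous_ev w; fun_prop)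
      (measurable_add_path μ).aemeasurable]
    simp only [Function.comp_def, map_add, LinearMap.add_apply, Real.exp_add]
    exact (hP.integrable_exp_ev w).mul_const _
  · rw [integral_map (measurable_add_path μ).aemeasurable
      (by have := continuous_ev w; fun_prop),
      integral_withDensity_eq_integral_toReal_smul₀ hdm
        (ae_of_all _ fun _ => ENNReal.ofReal_lt_top)]
    simp only [map_add, LinearMap.add_apply, Real.exp_add, integral_mul_const,
      hP.integral_exp_ev]
    -- Both exponentials merge into that of one Gaussian variable. In ‖w + L‖²/2 the cross term ⟨w,
    -- L⟩ equals `ev μ w`, which is the exponent produced by the shift.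
    have hmem : hP.toL2 w + L ∈ hP.gaussianSpace := add_mem (hP.toL2_mem w) hL
    have e : ∀ᵐ g ∂P₀, (ENNReal.ofReal (Real.exp (L g - ‖L‖ ^ 2 / 2))).toReal •
        Real.exp (ev g w) =
        Real.exp ((hP.toL2 w + L : Lp ℝ 2 P₀) g) * Real.exp (-(‖L‖ ^ 2 / 2)) := by
      filter_upwards [hP.coeFn_toL2 w, Lp.coeFn_add (hP.toL2 w) L] with g h1 h2
      rw [ENNReal.toReal_ofReal (Real.exp_pos _).le, h2, Pi.add_apply, h1, smul_eq_mul,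
        ← Real.exp_add, ← Real.exp_add]
      congr 1
      ring
    rw [integral_congr_ae e, integral_mul_const, hP.integral_exp hmem, ← Real.exp_add,
      ← Real.exp_add, norm_add_sq_real, real_inner_comm, hμ]
    congr 1
    ring

end GaussianSpace

/-! ### Regression on the value at θ₀: the maps ψ, h and their adjoints -/

section Regression

variable {Θ : Type*} [TopologicalSpace Θ] {k : ℕ} (Sig : CovFun Θ k) (θ₀ : Θ)

/-- The path `ψ(·) x`. -/
def psiPath : Vec k →ₗ[ℝ] Path Θ k where
  toFun x := ⟨fun t => op (psi Sig θ₀ t) x, continuous_op_apply (continuous_psi Sig θ₀) x⟩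
  map_add' x y := by ext1 t; exact map_add (op (psi Sig θ₀ t)) x y
  map_smul' c x := by ext1 t; exact map_smul (op (psi Sig θ₀ t)) c x

lemma psiPath_apply (x : Vec k) (t : Θ) : psiPath Sig θ₀ x t = op (psi Sig θ₀ t) x := rfl

lemma hPart_eq (g : Path Θ k) : hPart Sig θ₀ g = g - psiPath Sig θ₀ (g θ₀) := rfl

lemma meanFun_eq (θ : Θ) (μ : Path Θ k) :
    meanFun Sig θ₀ θ μ = μ - psiPath Sig θ₀ (op (psi Sig θ₀ θ)⁻¹ (μ θ)) := rfl

lemma hPart_add (g g' : Path Θ k) :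
    hPart Sig θ₀ (g + g') = hPart Sig θ₀ g + hPart Sig θ₀ g' := by
  simp only [hPart_eq, ContinuousMap.add_apply, map_add]
  abel

lemma hPart_eq_self {g : Path Θ k} (hg : g θ₀ = 0) : hPart Sig θ₀ g = g := by
  simp [hPart_eq, hg]

/-- The adjoint of `psiPath` with respect to `ev`. -/
def psiDual : (Θ →₀ Vec k) →ₗ[ℝ] Vec k :=
  Finsupp.lsum ℝ fun θ => (op (psi Sig θ₀ θ)ᵀ : Vec k →ₗ[ℝ] Vec k)

/-- The adjoint of `hPart` with respect to `ev`. -/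
def hDual : (Θ →₀ Vec k) →ₗ[ℝ] (Θ →₀ Vec k) :=
  LinearMap.id - (Finsupp.lsingle θ₀) ∘ₗ psiDual Sig θ₀

lemma hDual_apply (w : Θ →₀ Vec k) :
    hDual Sig θ₀ w = w - Finsupp.single θ₀ (psiDual Sig θ₀ w) := rfl

@[simp] lemma psiDual_single (θ : Θ) (v : Vec k) :
    psiDual Sig θ₀ (.single θ v) = op (psi Sig θ₀ θ)ᵀ v := by
  simp [psiDual]

lemma ev_psiPath (x : Vec k) (w : Θ →₀ Vec k) :
    ev (psiPath Sig θ₀ x) w = inner ℝ x (psiDual Sig θ₀ w) := by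
  induction w using Finsupp.induction_linear with
  | zero => simp
  | add w w' h h' => simp [h, h', inner_add_right]
  | single θ v => rw [ev_single, psiPath_apply, inner_op_left, psiDual_single]

lemma ev_hPart (g : Path Θ k) (w : Θ →₀ Vec k) :
    ev (hPart Sig θ₀ g) w = ev g (hDual Sig θ₀ w) := by
  rw [hPart_eq, hDual_apply, map_sub, map_sub, LinearMap.sub_apply, ev_psiPath, ev_single]

lemma continuous_psiPath : Continuous (psiPath Sig θ₀) :=
  (psiPath Sig θ₀).continuous_of_finiteDimensional

lemma continuous_hPart : Continuous (hPart (k := k) Sig θ₀) := by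
  have := continuous_psiPath Sig θ₀
  have h : hPart (k := k) Sig θ₀ = fun g => g - psiPath Sig θ₀ (g θ₀) := rfl
  rw [h]
  exact continuous_id.sub (this.comp (continuous_eval_const θ₀))

lemma measurable_hPart : Measurable (hPart (k := k) Sig θ₀) := (continuous_hPart Sig θ₀).measurable

variable {Sig θ₀}

lemma psi_self (h : IsUnit (Sig (θ₀, θ₀))) : psi Sig θ₀ θ₀ = 1 :=
  Matrix.mul_nonsing_inv _ ((Matrix.isUnit_iff_isUnit_det _).1 h)

lemma psiPath_self (h : IsUnit (Sig (θ₀, θ₀))) (x : Vec k) : psiPath Sig θ₀ x θ₀ = x := by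
  rw [psiPath_apply, psi_self h, op_one_apply]

lemma hPart_self (h : IsUnit (Sig (θ₀, θ₀))) (g : Path Θ k) : hPart Sig θ₀ g θ₀ = 0 := by
  simp [hPart_eq, psiPath_self h]

lemma hPart_psiPath (h : IsUnit (Sig (θ₀, θ₀))) (x : Vec k) :
    hPart Sig θ₀ (psiPath Sig θ₀ x) = 0 := by
  simp [hPart_eq, psiPath_self h]

lemma hPart_hPart_add_psiPath (h : IsUnit (Sig (θ₀, θ₀))) {g : Path Θ k} (hg : g θ₀ = 0)
    (x : Vec k) : hPart Sig θ₀ (g + psiPath Sig θ₀ x) = g := by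
  rw [hPart_add, hPart_psiPath h, add_zero, hPart_eq_self _ _ hg]

lemma psi_mul (h : IsUnit (Sig (θ₀, θ₀))) (θ : Θ) :
    psi Sig θ₀ θ * Sig (θ₀, θ₀) = Sig (θ, θ₀) :=
  Matrix.nonsing_inv_mul_cancel_right _ _ ((Matrix.isUnit_iff_isUnit_det _).1 h)

lemma covTilde_eq (θ θ' : Θ) :
    covTilde Sig θ₀ θ θ' = Sig (θ, θ') - psi Sig θ₀ θ * Sig (θ₀, θ') := rfl

lemma covTilde_self_right (h : IsUnit (Sig (θ₀, θ₀))) (θ : Θ) : covTilde Sig θ₀ θ θ₀ = 0 := by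
  rw [covTilde_eq, psi_mul h, sub_self]

variable (Sig θ₀)

lemma continuous_covTilde (θ' : Θ) : Continuous fun θ => covTilde Sig θ₀ θ θ' := by
  have h : (fun θ => covTilde Sig θ₀ θ θ') =
      fun θ => Sig (θ, θ') - psi Sig θ₀ θ * Sig (θ₀, θ') := rfl
  rw [h]
  exact (Sig.continuous.comp (by fun_prop : Continuous fun θ : Θ => (θ, θ'))).sub
    ((continuous_psi Sig θ₀).matrix_mul continuous_const)

/-- The finite linear combinations of the kernel functions `Σ̃(·, θ) v`, as paths. -/
def kerPath : (Θ →₀ Vec k) →ₗ[ℝ] Path Θ k :=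
  Finsupp.lsum ℝ fun θ' =>
    { toFun := fun v => ⟨fun t => op (covTilde Sig θ₀ t θ') v,
        continuous_op_apply (continuous_covTilde Sig θ₀ θ') v⟩
      map_add' := fun x y => by ext1 t; exact map_add (op (covTilde Sig θ₀ t θ')) x y
      map_smul' := fun c x => by ext1 t; exact map_smul (op (covTilde Sig θ₀ t θ')) c x }

lemma kerPath_single (θ' : Θ) (v : Vec k) (θ : Θ) :
    kerPath Sig θ₀ (.single θ' v) θ = op (covTilde Sig θ₀ θ θ') v := by
  rw [kerPath, Finsupp.lsum_single]
  rfl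

end Regression

/-! ### The nuisance space inside the Gaussian space, and independence of h and ξ -/

section Nuisance

variable {Θ : Type*} [MetricSpace Θ] [CompactSpace Θ] {k : ℕ} {Sig : CovFun Θ k} {θ₀ : Θ}
  {P₀ : Measure (Path Θ k)} [IsProbabilityMeasure P₀]

lemma IsGPLaw.transpose_covTilde (hP : IsGPLaw P₀ 0 Sig) (θ θ' : Θ) :
    (covTilde Sig θ₀ θ θ')ᵀ = covTilde Sig θ₀ θ' θ := by
  simp only [covTilde, Matrix.transpose_sub, Matrix.transpose_mul, hP.transpose_cov,
    Matrix.transpose_nonsing_inv, Matrix.mul_assoc]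

lemma IsGPLaw.inner_hDual_single (hP : IsGPLaw P₀ 0 Sig) (θ θ' : Θ) (v v' : Vec k) :
    inner ℝ (hP.toL2 (hDual Sig θ₀ (.single θ v))) (hP.toL2 (.single θ' v')) =
      inner ℝ v (op (covTilde Sig θ₀ θ θ') v') := by
  rw [hDual_apply, map_sub, inner_sub_left, hP.inner_toL2_single, psiDual_single,
    hP.inner_toL2_single, inner_op_left, Matrix.transpose_transpose, ← op_mul_apply,
    ← inner_sub_right, covTilde_eq]
  simp [op]

/-- Linear statistics of h are uncorrelated with ξ because Σ̃(·, θ₀) = 0. All later independence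
comes from this orthogonality. -/
lemma IsGPLaw.inner_hDual_toL2_base (hP : IsGPLaw P₀ 0 Sig) (h : IsUnit (Sig (θ₀, θ₀)))
    (w : Θ →₀ Vec k) (x : Vec k) :
    inner ℝ (hP.toL2 (hDual Sig θ₀ w)) (hP.toL2 (.single θ₀ x)) = 0 := by
  induction w using Finsupp.induction_linear with
  | zero => simp
  | add w w' h h' => simp [h, h', inner_add_left]
  | single θ v =>
    rw [hP.inner_hDual_single, covTilde_self_right h]
    simp [op]

lemma IsGPLaw.inner_hDual_hDual (hP : IsGPLaw P₀ 0 Sig) (h : IsUnit (Sig (θ₀, θ₀)))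
    (w w' : Θ →₀ Vec k) :
    inner ℝ (hP.toL2 (hDual Sig θ₀ w)) (hP.toL2 (hDual Sig θ₀ w')) =
      inner ℝ (hP.toL2 (hDual Sig θ₀ w)) (hP.toL2 w') := by
  rw [hDual_apply _ _ w', map_sub, inner_sub_right, hP.inner_hDual_toL2_base h, sub_zero]

/-- This exhibits the statistic ⟨h, w⟩ as the Cameron–Martin representer of the kernel combination
with weights w. -/
lemma IsGPLaw.ev_kerPath (hP : IsGPLaw P₀ 0 Sig) (w w' : Θ →₀ Vec k) :
    inner ℝ (hP.toL2 (hDual Sig θ₀ w)) (hP.toL2 w') = ev (kerPath Sig θ₀ w) w' := by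
  induction w using Finsupp.induction_linear with
  | zero => simp
  | add w w' h h' => simp [h, h', inner_add_left]
  | single θ v =>
    induction w' using Finsupp.induction_linear with
    | zero => simp
    | add w w' h h' => simp [h, h', inner_add_right]
    | single θ' v' =>
      rw [hP.inner_hDual_single, ev_single, kerPath_single, inner_op_left,
        hP.transpose_covTilde]

lemma ofKernel_kerFun_apply [Fact (kernelTilde Sig θ₀).PosSemidef] (θ θ' : Θ) (v : Vec k) :
    RKHS.kerFun (RKHS.OfKernel (kernelTilde Sig θ₀)) θ' v θ = op (covTilde Sig θ₀ θ θ') v := by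
  rw [RKHS.kerFun_apply, RKHS.OfKernel.kernel_ofKernel]
  rfl

lemma add_kerPath_mem_nuisanceSpace {μ : Path Θ k} (hμ : μ ∈ nuisanceSpace Sig θ₀)
    (w : Θ →₀ Vec k) : μ + kerPath Sig θ₀ w ∈ nuisanceSpace Sig θ₀ := by
  induction w using Finsupp.induction_linear generalizing μ with
  | zero => simpa
  | add w w' h h' =>
    rw [map_add, ← add_assoc]
    exact h' (h hμ)
  | single θ' v =>
    obtain ⟨hK, f, hf⟩ := hμ
    have : Fact (kernelTilde Sig θ₀).PosSemidef := ⟨hK⟩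
    refine ⟨hK, f + RKHS.kerFun (RKHS.OfKernel (kernelTilde Sig θ₀)) θ' v, fun θ => ?_⟩
    rw [RKHS.coe_add, Pi.add_apply, hf, ofKernel_kerFun_apply, ContinuousMap.add_apply,
      kerPath_single]

/-- The kernel section at θ₀ is zero, so the reproducing property forces the value at θ₀ to vanish.
Hence under θ₀ the mean function is μ itself and ξ is not shifted. -/
lemma apply_base_of_mem_nuisanceSpace (h : IsUnit (Sig (θ₀, θ₀))) {μ : Path Θ k}
    (hμ : μ ∈ nuisanceSpace Sig θ₀) : μ θ₀ = 0 := by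
  obtain ⟨hK, f, hf⟩ := hμ
  have : Fact (kernelTilde Sig θ₀).PosSemidef := ⟨hK⟩
  rw [← hf]
  refine ext_inner_left ℝ fun v => ?_
  have h0 : RKHS.kerFun (RKHS.OfKernel (kernelTilde Sig θ₀)) θ₀ v = 0 := by
    refine RKHS.ext fun θ => ?_
    rw [ofKernel_kerFun_apply, covTilde_self_right h]
    simp [op]
  rw [← RKHS.kerFun_inner, h0, inner_zero_left, inner_zero_right]

/-- Sending the kernel section at (θ, v) to the statistic ⟨h(θ), v⟩ preserves inner products,
because both have Gram kernel Σ̃. Kernel sections span a dense subspace, so approximations of f map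
to a Cauchy sequence, whose limit represents μ. -/
lemma IsGPLaw.exists_representer_of_rkhs (hP : IsGPLaw P₀ 0 Sig) (h : IsUnit (Sig (θ₀, θ₀)))
    {H : Type*} [NormedAddCommGroup H] [InnerProductSpace ℝ H] [CompleteSpace H]
    [RKHS ℝ H Θ (Vec k)]
    (hker : ∀ (θ θ' : Θ) (v : Vec k), RKHS.kerFun H θ' v θ = op (covTilde Sig θ₀ θ θ') v)
    {μ : Path Θ k} (f : H) (hf : ∀ θ, f θ = μ θ) :
    ∃ L ∈ hP.gaussianSpace, ∀ w, inner ℝ L (hP.toL2 w) = ev μ w := by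
  let B : (Θ →₀ Vec k) →ₗ[ℝ] H :=
    Finsupp.lsum ℝ fun θ => (RKHS.kerFun H θ : Vec k →ₗ[ℝ] H)
  have hB (θ : Θ) (v : Vec k) : B (.single θ v) = RKHS.kerFun H θ v := by simp [B]
  have hBev (w w' : Θ →₀ Vec k) :
      inner ℝ (B w) (B w') = inner ℝ (hP.toL2 (hDual Sig θ₀ w)) (hP.toL2 (hDual Sig θ₀ w')) := by
    rw [hP.inner_hDual_hDual h]
    induction w using Finsupp.induction_linear with
    | zero => simp
    | add w w' h h' => simp [h, h', inner_add_left]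
    | single θ v =>
      induction w' using Finsupp.induction_linear with
      | zero => simp
      | add w w' h h' => simp [h, h', inner_add_right]
      | single θ' v' =>
        rw [hP.inner_hDual_single, hB, hB, RKHS.kerFun_inner, hker]
  have hnorm (w : Θ →₀ Vec k) : ‖hP.toL2 (hDual Sig θ₀ w)‖ = ‖B w‖ := by
    rw [@norm_eq_sqrt_real_inner _ _ _ (B w), hBev, ← norm_eq_sqrt_real_inner]
  have hdense : f ∈ closure (LinearMap.range B : Set H) := by
    have h1 : Submodule.span ℝ {RKHS.kerFun H x v | (x) (v)} ≤ LinearMap.range B := by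
      rw [Submodule.span_le]
      rintro _ ⟨x, v, rfl⟩
      exact ⟨_, hB x v⟩
    have h2 := Submodule.topologicalClosure_mono h1
    rw [RKHS.kerFun_dense] at h2
    exact h2 (Submodule.mem_top (x := f))
  obtain ⟨b, hb, hbf⟩ := mem_closure_iff_seq_limit.1 hdense
  choose w hw using hb
  have hcau : CauchySeq fun n => hP.toL2 (hDual Sig θ₀ (w n)) := by
    have hbc := hbf.cauchySeq
    rw [Metric.cauchySeq_iff'] at hbc ⊢
    intro ε hε
    obtain ⟨n₀, hn₀⟩ := hbc ε hε
    refine ⟨n₀, fun n hn => ?_⟩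
    have := hn₀ n hn
    rwa [dist_eq_norm, ← hw, ← hw, ← map_sub, ← hnorm, map_sub, map_sub, ← dist_eq_norm] at this
  obtain ⟨L, hL⟩ := cauchySeq_tendsto_of_complete hcau
  refine ⟨L, ?_, fun w' => ?_⟩
  · exact (Submodule.isClosed_topologicalClosure _).mem_of_tendsto hL
      (Eventually.of_forall fun n => hP.toL2_mem _)
  · induction w' using Finsupp.induction_linear with
    | zero => simp
    | add w w' h h' => simp [h, h', inner_add_right]
    | single θ v =>
      have t1 : Tendsto (fun n => inner ℝ (hP.toL2 (hDual Sig θ₀ (w n))) (hP.toL2 (.single θ v)))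
          atTop (𝓝 (inner ℝ L (hP.toL2 (.single θ v)))) := hL.inner tendsto_const_nhds
      have t2 : Tendsto (fun n => inner ℝ (B (w n)) (B (.single θ v)))
          atTop (𝓝 (inner ℝ f (B (.single θ v)))) := by
        simp_rw [hw]
        exact hbf.inner tendsto_const_nhds
      simp_rw [hBev, hP.inner_hDual_hDual h] at t2
      rw [tendsto_nhds_unique t1 t2, hB, RKHS.inner_kerFun, ev_single, hf]

/-- Elements of the nuisance space are represented by elements of the Gaussian space. -/
lemma IsGPLaw.exists_representer (hP : IsGPLaw P₀ 0 Sig) (h : IsUnit (Sig (θ₀, θ₀)))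
    {μ : Path Θ k} (hμ : μ ∈ nuisanceSpace Sig θ₀) :
    ∃ L ∈ hP.gaussianSpace, ∀ w, inner ℝ L (hP.toL2 w) = ev μ w := by
  obtain ⟨hK, f, hf⟩ := hμ
  have : Fact (kernelTilde Sig θ₀).PosSemidef := ⟨hK⟩
  exact hP.exists_representer_of_rkhs h ofKernel_kerFun_apply f hf

/-- Under a nuisance shift the law of the observation is equivalent to the centered law. -/
lemma IsGPLaw.map_add_absolutelyContinuous (hP : IsGPLaw P₀ 0 Sig) (h : IsUnit (Sig (θ₀, θ₀)))
    {μ μ' : Path Θ k} (hμ : μ ∈ nuisanceSpace Sig θ₀) (hμ' : μ' ∈ nuisanceSpace Sig θ₀) :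
    P₀.map (fun g => g + μ) ≪ P₀.map (fun g => g + μ') := by
  obtain ⟨L, hL, hLμ⟩ := hP.exists_representer h hμ
  obtain ⟨L', hL', hLμ'⟩ := hP.exists_representer h hμ'
  rw [hP.map_add_eq_withDensity hL hLμ, hP.map_add_eq_withDensity hL' hLμ']
  refine (withDensity_absolutelyContinuous _ _).trans ?_
  refine withDensity_absolutelyContinuous' ?_ (ae_of_all _ fun g => ?_)
  · have := (Lp.aestronglyMeasurable L').aemeasurable
    fun_prop
  · simp [Real.exp_pos]

/-- `h` and `ξ` are independent: resampling `ξ` independently does not change the law. -/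
theorem IsGPLaw.map_hPart_add_psiPath (hP : IsGPLaw P₀ 0 Sig) (h : IsUnit (Sig (θ₀, θ₀))) :
    (P₀.prod P₀).map (fun p => hPart Sig θ₀ p.1 + psiPath Sig θ₀ (p.2 θ₀)) = P₀ := by
  have hm : Measurable fun p : Path Θ k × Path Θ k =>
      hPart Sig θ₀ p.1 + psiPath Sig θ₀ (p.2 θ₀) := by
    have := continuous_hPart (k := k) Sig θ₀
    have := continuous_psiPath Sig θ₀
    fun_prop
  have hev (p : Path Θ k × Path Θ k) (w : Θ →₀ Vec k) :
      Real.exp (ev (hPart Sig θ₀ p.1 + psiPath Sig θ₀ (p.2 θ₀)) w) =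
      Real.exp (ev p.1 (hDual Sig θ₀ w)) *
        Real.exp (ev p.2 (.single θ₀ (psiDual Sig θ₀ w))) := by
    rw [map_add, LinearMap.add_apply, ev_hPart, ev_psiPath, ev_single, Real.exp_add]
  have hc (w : Θ →₀ Vec k) : Continuous fun g : Path Θ k => Real.exp (ev g w) :=
    Real.continuous_exp.comp (continuous_ev w)
  refine measure_ext_of_mgf (fun w => ?_) fun w => ?_
  · rw [integrable_map_measure (hc w).aestronglyMeasurable hm.aemeasurable]
    simp only [Function.comp_def, hev]
    exact (hP.integrable_exp_ev _).mul_prod (hP.integrable_exp_ev _)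
  · rw [integral_map hm.aemeasurable (hc w).aestronglyMeasurable]
    simp only [hev]
    rw [integral_prod_mul (fun g : Path Θ k => Real.exp (ev g (hDual Sig θ₀ w)))
      (fun g : Path Θ k => Real.exp (ev g (.single θ₀ (psiDual Sig θ₀ w)))),
      hP.integral_exp_ev, hP.integral_exp_ev, hP.integral_exp_ev,
      ← Real.exp_add]
    -- The two summands are orthogonal in L², so the variance of the statistic splits as it does for
    -- independent h and ξ.
    have hw : w = hDual Sig θ₀ w + .single θ₀ (psiDual Sig θ₀ w) := by simp [hDual_apply]
    conv_rhs => rw [hw, map_add, norm_add_sq_real, hP.inner_hDual_toL2_base h]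
    congr 1
    ring

/-- The independence of h and ξ, in Fubini form: an inner integral over ξ with h held fixed. -/
lemma IsGPLaw.lintegral_eq (hP : IsGPLaw P₀ 0 Sig) (h : IsUnit (Sig (θ₀, θ₀)))
    {F : Path Θ k → ℝ≥0∞} (hF : Measurable F) :
    ∫⁻ g, F g ∂P₀ =
      ∫⁻ g, ∫⁻ x, F (hPart Sig θ₀ g + psiPath Sig θ₀ x) ∂(P₀.map fun g => g θ₀) ∂P₀ := by
  have c1 := continuous_hPart (k := k) Sig θ₀
  have c2 := continuous_psiPath Sig θ₀
  conv_lhs => rw [← hP.map_hPart_add_psiPath h]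
  rw [lintegral_map hF (by fun_prop), lintegral_prod _ (by fun_prop)]
  refine lintegral_congr fun g => ?_
  rw [lintegral_map (by fun_prop) (continuous_eval_const θ₀).measurable]

end Nuisance

/-! ### Completeness of h -/

section Completeness

variable {Θ : Type*} [MetricSpace Θ] [CompactSpace Θ] {k : ℕ} {Sig : CovFun Θ k} {θ₀ : Θ}
  {P₀ : Measure (Path Θ k)} [IsProbabilityMeasure P₀]

/-- Measure extensionality through exponential moments, with Lebesgue integrals. -/
theorem measure_ext_of_lintegral_exp {ν₁ ν₂ : Measure (Path Θ k)} [IsFiniteMeasure ν₁]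
    [IsFiniteMeasure ν₂] (hfin : ∀ w, ∫⁻ g, ENNReal.ofReal (Real.exp (ev g w)) ∂ν₁ ≠ ∞)
    (h : ∀ w, ∫⁻ g, ENNReal.ofReal (Real.exp (ev g w)) ∂ν₁ =
      ∫⁻ g, ENNReal.ofReal (Real.exp (ev g w)) ∂ν₂) : ν₁ = ν₂ := by
  have hc (w : Θ →₀ Vec k) : Continuous fun g : Path Θ k => Real.exp (ev g w) :=
    Real.continuous_exp.comp (continuous_ev w)
  have hpos (w : Θ →₀ Vec k) (g : Path Θ k) : 0 ≤ Real.exp (ev g w) := (Real.exp_pos _).le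
  refine measure_ext_of_mgf (fun w => ?_) fun w => ?_
  · exact (lintegral_ofReal_ne_top_iff_integrable (hc w).aestronglyMeasurable
      (ae_of_all _ (hpos w))).1 (hfin w)
  · rw [integral_eq_lintegral_of_nonneg_ae (ae_of_all _ (hpos w)) (hc w).aestronglyMeasurable,
      integral_eq_lintegral_of_nonneg_ae (ae_of_all _ (hpos w)) (hc w).aestronglyMeasurable, h]

lemma IsGPLaw.kerPath_base (hP : IsGPLaw P₀ 0 Sig) (h : IsUnit (Sig (θ₀, θ₀)))
    (w : Θ →₀ Vec k) : kerPath Sig θ₀ w θ₀ = 0 := by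
  refine ext_inner_right ℝ fun v => ?_
  rw [← ev_single, ← hP.ev_kerPath, hP.inner_hDual_toL2_base h, inner_zero_left]

/-- The Cameron–Martin density of a kernel shift is a function of h alone, since its representer is
a linear statistic of h. Means under shifts thereby become Laplace transforms of F d(law of h). -/
lemma IsGPLaw.lintegral_add_kerPath (hP : IsGPLaw P₀ 0 Sig) (h : IsUnit (Sig (θ₀, θ₀)))
    {F : Path Θ k → ℝ≥0∞} (hF : Measurable F) (w : Θ →₀ Vec k) :
    ∫⁻ g, F (hPart Sig θ₀ g) * ENNReal.ofReal (Real.exp (ev (hPart Sig θ₀ g) w)) ∂P₀ =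
      (∫⁻ g, F (hPart Sig θ₀ g + kerPath Sig θ₀ w) ∂P₀) *
        ENNReal.ofReal (Real.exp (‖hP.toL2 (hDual Sig θ₀ w)‖ ^ 2 / 2)) := by
  set L := hP.toL2 (hDual Sig θ₀ w) with hL
  have hh := measurable_hPart (k := k) Sig θ₀
  have e1 (g : Path Θ k) : F (hPart Sig θ₀ g + kerPath Sig θ₀ w) =
      F (hPart Sig θ₀ (g + kerPath Sig θ₀ w)) := by
    rw [hPart_add, hPart_eq_self _ _ (hP.kerPath_base h w)]
  have hLm : AEMeasurable L P₀ := (Lp.aestronglyMeasurable L).aemeasurable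
  have hFh : Measurable fun g => F (hPart Sig θ₀ g) := hF.comp hh
  have hdm : AEMeasurable (fun g => ENNReal.ofReal (Real.exp (L g - ‖L‖ ^ 2 / 2))) P₀ := by
    fun_prop
  simp_rw [e1]
  rw [← lintegral_map (μ := P₀) (f := fun g => F (hPart Sig θ₀ g))
    (g := fun g => g + kerPath Sig θ₀ w) hFh (measurable_add_path _),
    hP.map_add_eq_withDensity (hP.toL2_mem _) (hP.ev_kerPath w),
    lintegral_withDensity_eq_lintegral_mul₀ hdm hFh.aemeasurable,
    ← lintegral_mul_const'' _ (hdm.mul hFh.aemeasurable)]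
  refine lintegral_congr_ae ?_
  filter_upwards [hP.coeFn_toL2 (hDual Sig θ₀ w)] with g hg
  rw [Pi.mul_apply, ev_hPart, ← hg, ← hL, mul_comm _ (F _), mul_assoc,
    ← ENNReal.ofReal_mul (Real.exp_pos _).le, ← Real.exp_add]
  simp

/-- Completeness of the statistic `h` for the nuisance parameter. -/
theorem IsGPLaw.ae_eq_of_lintegral_add_kerPath (hP : IsGPLaw P₀ 0 Sig)
    (h : IsUnit (Sig (θ₀, θ₀))) {F : Path Θ k → ℝ≥0∞} (hF : Measurable F) {a : ℝ≥0∞}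
    (ha : a ≠ ∞) (hFa : ∀ w, ∫⁻ g, F (hPart Sig θ₀ g + kerPath Sig θ₀ w) ∂P₀ = a) :
    ∀ᵐ g ∂P₀, F (hPart Sig θ₀ g) = a := by
  have hh := measurable_hPart (k := k) Sig θ₀
  have key {F' : Path Θ k → ℝ≥0∞} (hF' : Measurable F')
      (hFa' : ∀ w, ∫⁻ g, F' (hPart Sig θ₀ g + kerPath Sig θ₀ w) ∂P₀ = a) (w : Θ →₀ Vec k) :
      ∫⁻ g, ENNReal.ofReal (Real.exp (ev g w)) ∂((P₀.map (hPart Sig θ₀)).withDensity F') =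
        a * ENNReal.ofReal (Real.exp (‖hP.toL2 (hDual Sig θ₀ w)‖ ^ 2 / 2)) := by
    have hm : Measurable fun g : Path Θ k => ENNReal.ofReal (Real.exp (ev g w)) := by
      have := measurable_ev (k := k) w
      fun_prop
    rw [lintegral_withDensity_eq_lintegral_mul _ hF' hm, lintegral_map (hF'.mul hm) hh,
      ← hFa' w, ← hP.lintegral_add_kerPath h hF' w]
    rfl
  have hfin {F' : Path Θ k → ℝ≥0∞} (hF' : Measurable F')
      (hFa' : ∀ w, ∫⁻ g, F' (hPart Sig θ₀ g + kerPath Sig θ₀ w) ∂P₀ = a) :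
      ∫⁻ g, F' g ∂(P₀.map (hPart Sig θ₀)) ≠ ∞ := by
    have := hFa' 0
    rw [lintegral_map hF' hh]
    simp only [map_zero, add_zero] at this
    rwa [this]
  -- The constant a satisfies the same hypothesis, so F and a weight the law of h to measures with
  -- equal exponential moments.
  have hone : ∀ w, ∫⁻ g, (fun _ => a) (hPart Sig θ₀ g + kerPath Sig θ₀ w) ∂P₀ = a := by simp
  have : IsFiniteMeasure ((P₀.map (hPart Sig θ₀)).withDensity F) :=
    isFiniteMeasure_withDensity (hfin hF hFa)
  have : IsFiniteMeasure ((P₀.map (hPart Sig θ₀)).withDensity fun _ => a) :=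
    isFiniteMeasure_withDensity (hfin measurable_const hone)
  have hν : (P₀.map (hPart Sig θ₀)).withDensity F =
      (P₀.map (hPart Sig θ₀)).withDensity fun _ => a := by
    refine measure_ext_of_lintegral_exp (fun w => ?_) fun w => ?_
    · rw [key hF hFa]
      exact ENNReal.mul_ne_top ha ENNReal.ofReal_ne_top
    · rw [key hF hFa, key measurable_const hone]
  rw [withDensity_eq_iff hF.aemeasurable aemeasurable_const (hfin hF hFa)] at hν
  exact ae_of_ae_map hh.aemeasurable hν

end Completeness

/-! ### Neyman structure of similar tests -/

section Similar

variable {Θ : Type*} [MetricSpace Θ] [CompactSpace Θ] {k : ℕ}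
  {Sig : CovFun Θ k} {θ₀ : Θ} {P₀ : Measure (Path Θ k)} [IsProbabilityMeasure P₀]

variable (Sig θ₀ P₀) in
/-- The conditional expectation of `F(g)` given `h` under the null. -/
def condNull (F : Path Θ k → ℝ≥0∞) (h : Path Θ k) : ℝ≥0∞ :=
  ∫⁻ x, F (h + psiPath Sig θ₀ x) ∂(P₀.map fun g => g θ₀)

lemma measurable_condNull {F : Path Θ k → ℝ≥0∞} (hF : Measurable F) :
    Measurable (condNull Sig θ₀ P₀ F) := by
  have c2 := continuous_psiPath Sig θ₀
  unfold condNull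
  exact Measurable.lintegral_prod_right' (f := fun p : Path Θ k × Vec k =>
    F (p.1 + psiPath Sig θ₀ p.2)) (by fun_prop)

lemma IsGPLaw.lintegral_eq_condNull (hP : IsGPLaw P₀ 0 Sig) (h : IsUnit (Sig (θ₀, θ₀)))
    {F : Path Θ k → ℝ≥0∞} (hF : Measurable F) {μ : Path Θ k} :
    ∫⁻ g, F (g + μ) ∂P₀ = ∫⁻ g, condNull Sig θ₀ P₀ F (hPart Sig θ₀ g + μ) ∂P₀ := by
  have hFμ : Measurable fun g => F (g + μ) := hF.comp (measurable_add_path μ)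
  rw [hP.lintegral_eq h hFμ]
  simp only [condNull, add_right_comm]

lemma gLaw_base {μ : Path Θ k} (hμ : μ θ₀ = 0) :
    gLaw Sig θ₀ P₀ θ₀ μ = P₀.map fun g => g + μ := by
  rw [gLaw, meanFun_eq, hμ]
  simp

/-- The conditional rejection probability given `h` of a similar test is constant. -/
theorem IsSimilarTest.condNull_ae_eq [MeasurableSpace Θ] (hP : IsGPLaw P₀ 0 Sig)
    (h : IsUnit (Sig (θ₀, θ₀))) {α : ℝ} {φ : Path Θ k → ℝ} (hφ : IsSimilarTest Sig θ₀ P₀ α φ)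
    {μ : Path Θ k} (hμ : μ ∈ nuisanceSpace Sig θ₀) :
    ∀ᵐ g ∂P₀, condNull Sig θ₀ P₀ (fun g => ENNReal.ofReal (φ g)) (hPart Sig θ₀ g + μ) =
      ENNReal.ofReal α := by
  have hm := hφ.measurable
  have hF : Measurable fun g => ENNReal.ofReal (φ g) := by fun_prop
  have hμ₀ := apply_base_of_mem_nuisanceSpace h hμ
  refine hP.ae_eq_of_lintegral_add_kerPath h
    (F := fun g => condNull Sig θ₀ P₀ (fun g => ENNReal.ofReal (φ g)) (g + μ))
    ((measurable_condNull hF).comp (measurable_add_path μ)) ENNReal.ofReal_ne_top fun w => ?_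
  have hmem := add_kerPath_mem_nuisanceSpace hμ w
  have := hφ.similar _ hmem
  rw [gLaw_base (apply_base_of_mem_nuisanceSpace h hmem),
    integral_map (measurable_add_path _).aemeasurable hm.aestronglyMeasurable,
    integral_eq_lintegral_of_nonneg_ae (ae_of_all _ fun g => (hφ.mem_Icc _).1)
      (hm.comp (measurable_add_path _)).aestronglyMeasurable] at this
  have hfin : ∫⁻ g, ENNReal.ofReal (φ (g + (μ + kerPath Sig θ₀ w))) ∂P₀ ≠ ∞ := by
    refine ne_top_of_le_ne_top ENNReal.one_ne_top
      ((lintegral_mono (g := fun _ => 1) fun g => ?_).trans (by simp))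
    exact ENNReal.ofReal_le_one.2 (hφ.mem_Icc _).2
  rw [← this, ENNReal.ofReal_toReal hfin, hP.lintegral_eq_condNull h hF]
  simp only [add_assoc, add_comm μ]

end Similar

/-! ### Gaussian likelihood ratios -/

section Likelihood

variable {k : ℕ}

/-- The likelihood ratio at `x` of `N(-c, S)` with respect to `N(0, S)`. -/
def likRatio (S : Matrix (Fin k) (Fin k) ℝ) (c x : Vec k) : ℝ :=
  Real.exp (-inner ℝ x (op S⁻¹ c) - inner ℝ c (op S⁻¹ c) / 2)

lemma likRatio_pos (S : Matrix (Fin k) (Fin k) ℝ) (c x : Vec k) : 0 < likRatio S c x :=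
  Real.exp_pos _

lemma likRatio_zero (S : Matrix (Fin k) (Fin k) ℝ) (x : Vec k) : likRatio S 0 x = 1 := by
  simp [likRatio]

lemma continuous_likRatio (S : Matrix (Fin k) (Fin k) ℝ) :
    Continuous fun p : Vec k × Vec k => likRatio S p.1 p.2 := by
  unfold likRatio
  fun_prop

lemma continuous_normalDensity (ν : Vec k) (S : Matrix (Fin k) (Fin k) ℝ) :
    Continuous (normalDensity ν S) := by
  unfold normalDensity
  fun_prop

lemma normalDensity_pos {S : Matrix (Fin k) (Fin k) ℝ} (hS : 0 < S.det) (ν x : Vec k) :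
    0 < normalDensity ν S x := by
  unfold normalDensity
  positivity

/-- The normalizing constants agree, and expanding the quadratic form leaves the N(0, S) factor.
Symmetry of S merges the two cross terms. -/
lemma normalDensity_neg {S : Matrix (Fin k) (Fin k) ℝ} (hS : Sᵀ = S) (c x : Vec k) :
    normalDensity (-c) S x = normalDensity 0 S x * likRatio S c x := by
  have hsym : inner ℝ c (op S⁻¹ x) = inner ℝ x (op S⁻¹ c) := by
    rw [real_inner_comm, inner_op_left, Matrix.transpose_nonsing_inv, hS]
  rw [normalDensity, normalDensity, likRatio, mul_assoc, ← Real.exp_add]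
  congr 2
  simp only [sub_neg_eq_add, sub_zero, map_add, inner_add_left, inner_add_right, hsym]
  ring

lemma continuous_op_apply₂ {X : Type*} [TopologicalSpace X]
    {M : X → Matrix (Fin k) (Fin k) ℝ} (hM : Continuous M) {v : X → Vec k} (hv : Continuous v) :
    Continuous fun x => op (M x) (v x) :=
  (PiLp.continuous_toLp 2 _).comp (hM.matrix_mulVec ((PiLp.continuous_ofLp 2 _).comp hv))

lemma continuous_matrix_inv {X : Type*} [TopologicalSpace X]
    {M : X → Matrix (Fin k) (Fin k) ℝ} (hM : Continuous M) (hu : ∀ x, IsUnit (M x)) :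
    Continuous fun x => (M x)⁻¹ := by
  simp only [Matrix.inv_def, Ring.inverse_eq_inv']
  exact (hM.matrix_det.inv₀ fun x =>
    ((Matrix.isUnit_iff_isUnit_det _).1 (hu x)).ne_zero).smul hM.matrix_adjugate

end Likelihood

/-! ### The effect of θ: a shift of ξ with h fixed -/

section Shift

variable {Θ : Type*} [MetricSpace Θ] [CompactSpace Θ] {k : ℕ}
  {Sig : CovFun Θ k} {θ₀ : Θ} {P₀ : Measure (Path Θ k)} [IsProbabilityMeasure P₀]

variable (Sig θ₀) in
/-- The vector `ψ(θ)⁻¹ μ(θ)`. -/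
def shiftVec (θ : Θ) (μ : Path Θ k) : Vec k := op (psi Sig θ₀ θ)⁻¹ (μ θ)

lemma isUnit_psi (hrank : ∀ θ, IsUnit (Sig (θ, θ₀))) (θ : Θ) : IsUnit (psi Sig θ₀ θ) :=
  (hrank θ).mul ((Matrix.isUnit_nonsing_inv_iff).2 (hrank θ₀))

lemma continuous_shiftVec (hrank : ∀ θ, IsUnit (Sig (θ, θ₀))) :
    Continuous fun p : Θ × Path Θ k => shiftVec Sig θ₀ p.1 p.2 := by
  unfold shiftVec
  exact continuous_op_apply₂
    (continuous_matrix_inv ((continuous_psi Sig θ₀).comp continuous_fst)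
      fun p => isUnit_psi hrank p.1) (by fun_prop)

lemma meanFun_eq_sub (θ : Θ) (μ : Path Θ k) :
    meanFun Sig θ₀ θ μ = μ - psiPath Sig θ₀ (shiftVec Sig θ₀ θ μ) := rfl

lemma continuous_meanFun (hrank : ∀ θ, IsUnit (Sig (θ, θ₀))) :
    Continuous fun p : Θ × Path Θ k => meanFun Sig θ₀ p.1 p.2 := by
  simp_rw [meanFun_eq_sub]
  exact continuous_snd.sub ((continuous_psiPath Sig θ₀).comp (continuous_shiftVec hrank))

/-- The parameter θ enters the mean only through a multiple of ψ, which h does not see. So the law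
of h does not depend on θ. -/
lemma hPart_add_meanFun (h : IsUnit (Sig (θ₀, θ₀))) (g : Path Θ k) (θ : Θ) (μ : Path Θ k) :
    hPart Sig θ₀ (g + meanFun Sig θ₀ θ μ) = hPart Sig θ₀ (g + μ) := by
  rw [meanFun_eq_sub, sub_eq_add_neg, ← map_neg, ← add_assoc, hPart_add, hPart_psiPath h, add_zero]

lemma IsGPLaw.det_pos (hP : IsGPLaw P₀ 0 Sig) (h : IsUnit (Sig (θ₀, θ₀))) :
    0 < (Sig (θ₀, θ₀)).det := by
  have hpsd : (Sig (θ₀, θ₀)).PosSemidef := by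
    refine Matrix.PosSemidef.of_dotProduct_mulVec_nonneg ?_ fun x => ?_
    · rw [Matrix.IsHermitian, Matrix.conjTranspose_eq_transpose_of_trivial, hP.transpose_cov]
    · have := hP.inner_toL2_single θ₀ θ₀ (WithLp.toLp 2 x) (WithLp.toLp 2 x)
      rw [real_inner_self_eq_norm_sq] at this
      have h2 : star x ⬝ᵥ (Sig (θ₀, θ₀)).mulVec x =
          inner ℝ (WithLp.toLp 2 x : Vec k) (op (Sig (θ₀, θ₀)) (WithLp.toLp 2 x)) := by
        simp [op, PiLp.inner_apply, dotProduct, mul_comm]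
      rw [h2, ← this]
      positivity
  exact lt_of_le_of_ne hpsd.det_nonneg
    ((Matrix.isUnit_iff_isUnit_det _).1 h).ne_zero.symm

lemma IsGPLaw.lik_eq (hP : IsGPLaw P₀ 0 Sig) (μ : Path Θ k) (θ : Θ) (x : Vec k) :
    lik Sig θ₀ μ θ x = normalDensity 0 (Sig (θ₀, θ₀)) x *
      likRatio (Sig (θ₀, θ₀)) (shiftVec Sig θ₀ θ μ) x :=
  normalDensity_neg (hP.transpose_cov _ _) _ _

/-- Change of measure for shifts of `ξ` with `h` fixed. -/
lemma IsGPLaw.lintegral_sub_psiPath (hP : IsGPLaw P₀ 0 Sig) (h : IsUnit (Sig (θ₀, θ₀)))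
    {F : Path Θ k → ℝ≥0∞} (hF : Measurable F) (c : Vec k) :
    ∫⁻ g, F (g - psiPath Sig θ₀ c) ∂P₀ =
      ∫⁻ g, F g * ENNReal.ofReal (likRatio (Sig (θ₀, θ₀)) c (g θ₀)) ∂P₀ := by
  set S := Sig (θ₀, θ₀) with hS
  have hdet : IsUnit S.det := (Matrix.isUnit_iff_isUnit_det _).1 h
  -- The shift by -ψ(·)c is represented by the statistic -⟨S⁻¹c, ξ⟩, so its Cameron–Martin density
  -- is the likelihood ratio at ξ.
  set L := hP.toL2 (.single θ₀ (-op S⁻¹ c)) with hL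
  have hrep (w : Θ →₀ Vec k) : inner ℝ L (hP.toL2 w) = ev (-psiPath Sig θ₀ c) w := by
    induction w using Finsupp.induction_linear with
    | zero => simp
    | add w w' h h' => rw [map_add, inner_add_right, h, h', map_add]
    | single θ v =>
      rw [hL, hP.inner_toL2_single, ev_single, ContinuousMap.neg_apply, psiPath_apply,
        inner_neg_left, inner_neg_left, psi, op_mul_apply, inner_op_left (Sig (θ, θ₀)),
        hP.transpose_cov]
  have hnorm : ‖L‖ ^ 2 = inner ℝ c (op S⁻¹ c) := by
    rw [← real_inner_self_eq_norm_sq, hL, hP.inner_toL2_single, map_neg, inner_neg_neg, ← hS,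
      ← op_mul_apply, Matrix.mul_nonsing_inv _ hdet, op_one_apply, real_inner_comm]
  have hLm : AEMeasurable L P₀ := (Lp.aestronglyMeasurable L).aemeasurable
  have hdm : AEMeasurable (fun g => ENNReal.ofReal (Real.exp (L g - ‖L‖ ^ 2 / 2))) P₀ := by
    fun_prop
  simp_rw [sub_eq_add_neg _ (psiPath Sig θ₀ c)]
  rw [← lintegral_map (μ := P₀) (f := F) hF (measurable_add_path _),
    hP.map_add_eq_withDensity (hP.toL2_mem _) hrep,
    lintegral_withDensity_eq_lintegral_mul₀ hdm hF.aemeasurable]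
  refine lintegral_congr_ae ?_
  filter_upwards [hP.coeFn_toL2 (.single θ₀ (-op S⁻¹ c))] with g hg
  rw [Pi.mul_apply, mul_comm, hnorm, hL, hg, ev_single, inner_neg_right, likRatio]

end Shift

attribute [irreducible] likRatio shiftVec

/-! ### Measurability of integrals against kernels -/

section KernelMeasurability

variable {A B C : Type*} [MeasurableSpace A] [MeasurableSpace B] [MeasurableSpace C]

lemma measurable_lintegral_kernel_comp {κ : Kernel B C} [IsSFiniteKernel κ]
    {f : A × C → ℝ≥0∞} (hf : Measurable f) {e : A → B} (he : Measurable e) :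
    Measurable fun a => ∫⁻ c, f (a, c) ∂κ (e a) :=
  Measurable.lintegral_kernel_prod_right' (κ := κ.comap e he) hf

lemma stronglyMeasurable_integral_kernel_comp {κ : Kernel B C} [IsSFiniteKernel κ]
    {f : A × C → ℝ} (hf : StronglyMeasurable f) {e : A → B} (he : Measurable e) :
    StronglyMeasurable fun a => ∫ c, f (a, c) ∂κ (e a) :=
  StronglyMeasurable.integral_kernel_prod_right' (κ := κ.comap e he) hf

end KernelMeasurability

/-! ### The posterior and weighted average power -/

section Bayes

variable {Θ : Type*} [MetricSpace Θ] [CompactSpace Θ] [MeasurableSpace Θ] [BorelSpace Θ] {k : ℕ}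
  {Sig : CovFun Θ k} {θ₀ : Θ} {P₀ : Measure (Path Θ k)} [IsProbabilityMeasure P₀]
  {πθ : Measure Θ} [IsProbabilityMeasure πθ] {πμ : Measure (Path Θ k)} [IsProbabilityMeasure πμ]

lemma measurable_add_meanFun (hrank : ∀ θ, IsUnit (Sig (θ, θ₀))) :
    Measurable fun z : (Θ × Path Θ k) × Path Θ k => z.2 + meanFun Sig θ₀ z.1.1 z.1.2 := by
  have := (continuous_meanFun hrank).measurable
  exact measurable_snd.add (this.comp measurable_fst)

lemma measurable_likRatio_shiftVec (hrank : ∀ θ, IsUnit (Sig (θ, θ₀))) :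
    Measurable fun z : (Θ × Path Θ k) × Vec k =>
      likRatio (Sig (θ₀, θ₀)) (shiftVec Sig θ₀ z.1.1 z.1.2) z.2 := by
  have h1 := (continuous_shiftVec hrank).measurable
  have h2 := (continuous_likRatio (Sig (θ₀, θ₀))).measurable
  exact h2.comp ((h1.comp measurable_fst).prodMk measurable_snd)

variable (Sig θ₀ P₀ πμ) in
/-- The joint law of `(h, μ)` when `μ ~ π(μ)`. -/
def nuisanceJoint : Measure (Path Θ k × Path Θ k) :=
  (πμ.prod P₀).map fun p => (hPart Sig θ₀ (p.2 + p.1), p.1)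

variable (Sig θ₀ P₀ πμ) in
/-- The marginal law of `h` when `μ ~ π(μ)`. -/
def hLaw : Measure (Path Θ k) := (πμ.prod P₀).map fun p => hPart Sig θ₀ (p.2 + p.1)

lemma measurable_hPart_add :
    Measurable fun p : Path Θ k × Path Θ k => hPart Sig θ₀ (p.2 + p.1) :=
  (measurable_hPart Sig θ₀).comp (measurable_snd.add measurable_fst)

instance : IsProbabilityMeasure (hLaw Sig θ₀ P₀ πμ) :=
  Measure.isProbabilityMeasure_map measurable_hPart_add.aemeasurable

/-- The posterior kernel disintegrates the joint law of `(h, μ)`. -/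
lemma hLaw_compProd_posterior (hrank : ∀ θ, IsUnit (Sig (θ, θ₀))) :
    hLaw Sig θ₀ P₀ πμ ⊗ₘ posteriorNuisance Sig θ₀ P₀ πθ πμ = nuisanceJoint Sig θ₀ P₀ πμ := by
  have hm := measurable_add_meanFun hrank
  have hh := measurable_hPart (k := k) Sig θ₀
  -- The pair (h, μ) does not involve θ, so the prior on θ integrates out.
  have hproj : ((πθ.prod πμ).prod P₀).map (fun z => (z.1.2, z.2)) = πμ.prod P₀ := by
    have := Measure.map_prod_map (πθ.prod πμ) P₀ (f := Prod.snd) (g := id) measurable_snd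
      measurable_id
    rw [Measure.map_snd_prod, Measure.map_id, measure_univ, one_smul] at this
    exact this.symm
  have hjoint {X : Type _} [MeasurableSpace X] {f : Path Θ k × Path Θ k → X} (hf : Measurable f) :
      (jointLaw Sig θ₀ P₀ πθ πμ).map (fun z => f (hPart Sig θ₀ z.2, z.1.2)) =
        (πμ.prod P₀).map fun p => f (hPart Sig θ₀ (p.2 + p.1), p.1) := by
    rw [jointLaw, Measure.map_map (by fun_prop) (by fun_prop), ← hproj, Measure.map_map]
    · simp only [Function.comp_def, hPart_add_meanFun (hrank θ₀)]
    · exact hf.comp (measurable_hPart_add.prodMk measurable_fst)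
    · fun_prop
  have h1 : (jointLaw Sig θ₀ P₀ πθ πμ).map (fun z => hPart Sig θ₀ z.2) = hLaw Sig θ₀ P₀ πμ :=
    hjoint measurable_fst
  rw [← h1, posteriorNuisance, compProd_map_condDistrib (by fun_prop)]
  exact hjoint measurable_id

variable (Sig θ₀ P₀ πθ πμ) in
/-- The integrated likelihood ratio given `h`, as a function of `ξ`. -/
def intLikRatio (h : Path Θ k) (x : Vec k) : ℝ≥0∞ :=
  ∫⁻ θ, ∫⁻ μ, ENNReal.ofReal (likRatio (Sig (θ₀, θ₀)) (shiftVec Sig θ₀ θ μ) x)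
    ∂(posteriorNuisance Sig θ₀ P₀ πθ πμ h) ∂πθ

instance : IsMarkovKernel (posteriorNuisance Sig θ₀ P₀ πθ πμ) := by
  unfold posteriorNuisance; infer_instance

lemma measurable_intLikRatio (hrank : ∀ θ, IsUnit (Sig (θ, θ₀))) :
    Measurable fun p : Path Θ k × Vec k => intLikRatio Sig θ₀ P₀ πθ πμ p.1 p.2 := by
  have hl := (measurable_likRatio_shiftVec hrank).ennreal_ofReal
  have h1 : Measurable fun q : (Path Θ k × Vec k) × Θ =>
      ∫⁻ μ, ENNReal.ofReal (likRatio (Sig (θ₀, θ₀)) (shiftVec Sig θ₀ q.2 μ) q.1.2)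
        ∂(posteriorNuisance Sig θ₀ P₀ πθ πμ q.1.1) :=
    measurable_lintegral_kernel_comp
      (f := fun r : ((Path Θ k × Vec k) × Θ) × Path Θ k =>
        ENNReal.ofReal (likRatio (Sig (θ₀, θ₀)) (shiftVec Sig θ₀ r.1.2 r.2) r.1.1.2))
      (hl.comp (by fun_prop : Measurable fun r : ((Path Θ k × Vec k) × Θ) × Path Θ k =>
        ((r.1.2, r.2), r.1.1.2))) (by fun_prop)
  exact h1.lintegral_prod_right'

set_option maxHeartbeats 2000000 in
/-- Weighted average power in terms of the integrated likelihood ratio. -/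
theorem IsGPLaw.lintegral_gLaw_eq (hP : IsGPLaw P₀ 0 Sig) (hrank : ∀ θ, IsUnit (Sig (θ, θ₀)))
    (hπμ : ∀ᵐ μ ∂πμ, μ ∈ nuisanceSpace Sig θ₀) {φ : Path Θ k → ℝ≥0∞} (hφ : Measurable φ) :
    ∫⁻ p, ∫⁻ g, φ g ∂(gLaw Sig θ₀ P₀ p.1 p.2) ∂(πθ.prod πμ) =
      ∫⁻ h, ∫⁻ x, φ (h + psiPath Sig θ₀ x) * intLikRatio Sig θ₀ P₀ πθ πμ h x
        ∂(P₀.map fun g => g θ₀) ∂(hLaw Sig θ₀ P₀ πμ) := by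
  have hu := hrank θ₀
  have hh := measurable_hPart (k := k) Sig θ₀
  have hl := (measurable_likRatio_shiftVec hrank).ennreal_ofReal
  have hψ := (continuous_psiPath Sig θ₀).measurable
  set N := P₀.map fun g => g θ₀
  have : IsProbabilityMeasure N :=
    Measure.isProbabilityMeasure_map (continuous_eval_const θ₀).measurable.aemeasurable
  set κ := posteriorNuisance Sig θ₀ P₀ πθ πμ with hκ
  let Ψ (θ : Θ) (h μ : Path Θ k) : ℝ≥0∞ := ∫⁻ x, φ (h + psiPath Sig θ₀ x) *
    ENNReal.ofReal (likRatio (Sig (θ₀, θ₀)) (shiftVec Sig θ₀ θ μ) x) ∂N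
  have hΨint : Measurable fun r : (Θ × Path Θ k × Path Θ k) × Vec k =>
      φ (r.1.2.1 + psiPath Sig θ₀ r.2) *
        ENNReal.ofReal (likRatio (Sig (θ₀, θ₀)) (shiftVec Sig θ₀ r.1.1 r.1.2.2) r.2) :=
    (hφ.comp (by fun_prop)).mul
      (hl.comp (by fun_prop : Measurable fun r : (Θ × Path Θ k × Path Θ k) × Vec k =>
        ((r.1.1, r.1.2.2), r.2)))
  have hΨ : Measurable fun q : Θ × Path Θ k × Path Θ k => Ψ q.1 q.2.1 q.2.2 :=
    hΨint.lintegral_prod_right'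
  -- First the shift of ξ is traded for the likelihood ratio. Then ξ is integrated separately from
  -- h, and μ(θ₀) = 0 keeps the shift by μ inside h.
  have step1 (θ : Θ) (μ : Path Θ k) (hμ : μ θ₀ = 0) :
      ∫⁻ g, φ g ∂(gLaw Sig θ₀ P₀ θ μ) = ∫⁻ g, Ψ θ (hPart Sig θ₀ (g + μ)) μ ∂P₀ := by
    have hφμ : Measurable fun g => φ (g + μ) := hφ.comp (measurable_add_path μ)
    have hlg : Measurable fun g : Path Θ k => ENNReal.ofReal
        (likRatio (Sig (θ₀, θ₀)) (shiftVec Sig θ₀ θ μ) (g θ₀)) :=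
      hl.comp ((measurable_const (a := (θ, μ))).prodMk (continuous_eval_const θ₀).measurable)
    rw [gLaw, lintegral_map hφ (measurable_add_path _)]
    simp_rw [meanFun_eq_sub, ← add_sub_assoc, add_sub_right_comm]
    rw [hP.lintegral_sub_psiPath hu hφμ, hP.lintegral_eq hu (F := fun g => φ (g + μ) *
      ENNReal.ofReal (likRatio (Sig (θ₀, θ₀)) (shiftVec Sig θ₀ θ μ) (g θ₀))) (hφμ.mul hlg)]
    refine lintegral_congr fun g => lintegral_congr fun x => ?_
    rw [hPart_add, hPart_eq_self _ _ hμ, ContinuousMap.add_apply, hPart_self hu,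
      psiPath_self hu, zero_add, add_right_comm]
  have hpower : Measurable fun p : Θ × Path Θ k => ∫⁻ g, φ g ∂(gLaw Sig θ₀ P₀ p.1 p.2) := by
    have : ∀ p : Θ × Path Θ k, ∫⁻ g, φ g ∂(gLaw Sig θ₀ P₀ p.1 p.2) =
        ∫⁻ g, φ (g + meanFun Sig θ₀ p.1 p.2) ∂P₀ := fun p => by
      rw [gLaw, lintegral_map hφ (measurable_add_path _)]
    simp_rw [this]
    exact (hφ.comp (measurable_add_meanFun hrank)).lintegral_prod_right'
  have step2 (θ : Θ) : ∫⁻ μ, ∫⁻ g, φ g ∂(gLaw Sig θ₀ P₀ θ μ) ∂πμ =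
      ∫⁻ h, ∫⁻ μ, Ψ θ h μ ∂κ h ∂(hLaw Sig θ₀ P₀ πμ) := by
    have hΨθ : Measurable fun q : Path Θ k × Path Θ k => Ψ θ q.1 q.2 :=
      hΨ.comp measurable_prodMk_left
    have hΨh : Measurable fun p : Path Θ k × Path Θ k => Ψ θ (hPart Sig θ₀ (p.2 + p.1)) p.1 :=
      hΨθ.comp (measurable_hPart_add.prodMk measurable_fst)
    have e : ∫⁻ μ, ∫⁻ g, φ g ∂(gLaw Sig θ₀ P₀ θ μ) ∂πμ =
        ∫⁻ μ, ∫⁻ g, Ψ θ (hPart Sig θ₀ (g + μ)) μ ∂P₀ ∂πμ := by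
      refine lintegral_congr_ae ?_
      filter_upwards [hπμ] with μ hμ
      exact step1 θ μ (apply_base_of_mem_nuisanceSpace hu hμ)
    rw [e, ← Measure.lintegral_compProd hΨθ, hκ, hLaw_compProd_posterior hrank, nuisanceJoint,
      lintegral_map hΨθ (measurable_hPart_add.prodMk measurable_fst), lintegral_prod _
      hΨh.aemeasurable]
  rw [lintegral_prod _ hpower.aemeasurable]
  simp_rw [step2]
  -- Tonelli moves h outermost, and then x outside θ and μ, so that the inner integral over the
  -- prior and the posterior is W(h, x).
  rw [lintegral_lintegral_swap]
  swap
  · exact (measurable_lintegral_kernel_comp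
      (f := fun r : (Θ × Path Θ k) × Path Θ k => Ψ r.1.1 r.1.2 r.2)
      (hΨ.comp (by fun_prop : Measurable fun r : (Θ × Path Θ k) × Path Θ k =>
        (r.1.1, r.1.2, r.2))) measurable_snd).aemeasurable
  refine lintegral_congr fun h => ?_
  have hf : Measurable fun r : (Θ × Path Θ k) × Vec k => φ (h + psiPath Sig θ₀ r.2) *
      ENNReal.ofReal (likRatio (Sig (θ₀, θ₀)) (shiftVec Sig θ₀ r.1.1 r.1.2) r.2) :=
    hΨint.comp (by fun_prop : Measurable fun r : (Θ × Path Θ k) × Vec k =>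
      ((r.1.1, h, r.1.2), r.2))
  rw [lintegral_lintegral (f := fun θ μ => Ψ θ h μ)
    (hΨ.comp (by fun_prop : Measurable fun r : Θ × Path Θ k => (r.1, h, r.2))).aemeasurable]
  simp only [Ψ]
  rw [lintegral_lintegral_swap hf.aemeasurable]
  refine lintegral_congr fun x => ?_
  have hlx : Measurable fun z : Θ × Path Θ k => ENNReal.ofReal
      (likRatio (Sig (θ₀, θ₀)) (shiftVec Sig θ₀ z.1 z.2) x) := hl.comp measurable_prodMk_right
  rw [lintegral_const_mul _ hlx, lintegral_prod _ hlx.aemeasurable, intLikRatio]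

end Bayes

/-! ### Quantiles of laws on the line -/

section Quantile

variable {ν : Measure ℝ} [IsProbabilityMeasure ν] {q : ℝ}

lemma quantile_mem (hq₀ : 0 < q) (hq₁ : q < 1) :
    q ≤ ν.real (Iic (quantile ν q)) ∧ BddBelow {x : ℝ | q ≤ ν.real (Iic x)} := by
  have hne : {x : ℝ | q ≤ ν.real (Iic x)}.Nonempty := by
    obtain ⟨x, hx⟩ := ((tendsto_cdf_atTop ν).eventually_const_le hq₁).exists
    exact ⟨x, by rwa [cdf_eq_real] at hx⟩
  have hbdd : BddBelow {x : ℝ | q ≤ ν.real (Iic x)} := by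
    obtain ⟨b, hb⟩ := ((tendsto_cdf_atBot ν).eventually_lt_const hq₀).exists
    refine ⟨b, fun x hx => ?_⟩
    by_contra! hlt
    have := monotone_cdf ν hlt.le
    rw [cdf_eq_real ν x] at this
    exact absurd (hx.trans this) (not_le.2 hb)
  refine ⟨?_, hbdd⟩
  rw [← cdf_eq_real]
  have hcont := (cdf ν).right_continuous (quantile ν q)
  refine ge_of_tendsto (hcont.mono_left (nhdsWithin_mono _ Ioi_subset_Ici_self)) ?_
  filter_upwards [self_mem_nhdsWithin] with x hx
  obtain ⟨s, hs, hsx⟩ := exists_lt_of_csInf_lt hne (mem_Ioi.1 hx)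
  have := monotone_cdf ν hsx.le
  rw [cdf_eq_real ν s] at this
  exact le_trans hs this

/-- Right continuity of the distribution function makes the infimum attained. This equivalence also
yields measurability of quantiles of a kernel. -/
lemma quantile_le_iff (hq₀ : 0 < q) (hq₁ : q < 1) (x : ℝ) :
    quantile ν q ≤ x ↔ q ≤ ν.real (Iic x) := by
  obtain ⟨h, hbdd⟩ := quantile_mem (ν := ν) hq₀ hq₁
  exact ⟨fun hx => h.trans (measureReal_mono (Iic_subset_Iic.2 hx)), fun hx => csInf_le hbdd hx⟩

lemma measure_Ioi_quantile (hq₀ : 0 < q) (hq₁ : q < 1) (hν : ∀ x, ν {x} = 0) :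
    ν (Ioi (quantile ν q)) = ENNReal.ofReal (1 - q) := by
  set c := quantile ν q
  have h1 : q ≤ cdf ν c := by
    rw [cdf_eq_real]
    exact (quantile_mem hq₀ hq₁).1
  have h2 : cdf ν c ≤ q := by
    -- Without an atom at c the distribution function equals its left limit there, and to the left
    -- of the quantile it stays below q.
    have hs := (cdf ν).measure_singleton c
    rw [measure_cdf, hν, eq_comm, ENNReal.ofReal_eq_zero, sub_nonpos] at hs
    refine hs.trans (le_of_tendsto ((monotone_cdf ν).tendsto_leftLim c) ?_)
    filter_upwards [self_mem_nhdsWithin] with x hx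
    rw [cdf_eq_real]
    by_contra! hlt
    exact absurd ((quantile_le_iff hq₀ hq₁ x).2 hlt.le) (not_le.2 hx)
  rw [← ofReal_measureReal, ← compl_Iic, probReal_compl_eq_one_sub measurableSet_Iic,
    ← cdf_eq_real, le_antisymm h2 h1]

lemma measurable_quantile {B : Type*} [MeasurableSpace B] (κ : Kernel B ℝ) [IsMarkovKernel κ]
    (hq₀ : 0 < q) (hq₁ : q < 1) : Measurable fun b => quantile (κ b) q := by
  refine measurable_of_Iic fun x => ?_
  have : (fun b => quantile (κ b) q) ⁻¹' Iic x = {b | q ≤ (κ b).real (Iic x)} := by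
    ext b
    exact quantile_le_iff hq₀ hq₁ x
  rw [this]
  exact measurableSet_le measurable_const (κ.measurable_coe measurableSet_Iic).ennreal_toReal

end Quantile

/-! ### The test statistic as an integrated likelihood ratio -/

section Bayes

variable {Θ : Type*} [MetricSpace Θ] [CompactSpace Θ] [MeasurableSpace Θ] [BorelSpace Θ] {k : ℕ}
  {Sig : CovFun Θ k} {θ₀ : Θ} {P₀ : Measure (Path Θ k)} [IsProbabilityMeasure P₀]
  {πθ : Measure Θ} [IsProbabilityMeasure πθ] {πμ : Measure (Path Θ k)} [IsProbabilityMeasure πμ]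

lemma IsGPLaw.stronglyMeasurable_ellStar (hP : IsGPLaw P₀ 0 Sig)
    (hrank : ∀ θ, IsUnit (Sig (θ, θ₀))) :
    StronglyMeasurable fun p : Path Θ k × Θ => ellStar Sig θ₀ P₀ πθ πμ p.2 p.1 := by
  have hev : Measurable fun g : Path Θ k => g θ₀ := (continuous_eval_const θ₀).measurable
  have hn : Measurable (normalDensity 0 (Sig (θ₀, θ₀))) :=
    (continuous_normalDensity 0 (Sig (θ₀, θ₀))).measurable
  have hl := measurable_likRatio_shiftVec hrank
  have hh := measurable_hPart (k := k) Sig θ₀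
  have hm : Measurable fun r : (Path Θ k × Θ) × Path Θ k => lik Sig θ₀ r.2 r.1.2 (r.1.1 θ₀) := by
    simp_rw [hP.lik_eq]
    exact (hn.comp (by fun_prop)).mul (hl.comp
      (by fun_prop : Measurable fun r : (Path Θ k × Θ) × Path Θ k =>
        ((r.1.2, r.2), r.1.1 θ₀)))
  exact stronglyMeasurable_integral_kernel_comp
    (f := fun r : (Path Θ k × Θ) × Path Θ k => lik Sig θ₀ r.2 r.1.2 (r.1.1 θ₀))
    hm.stronglyMeasurable (hh.comp measurable_fst)

lemma IsGPLaw.measurable_stat (hP : IsGPLaw P₀ 0 Sig) (hrank : ∀ θ, IsUnit (Sig (θ, θ₀))) :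
    Measurable (stat Sig θ₀ P₀ πθ πμ) := by
  have h := hP.stronglyMeasurable_ellStar (πθ := πθ) (πμ := πμ) hrank
  exact h.integral_prod_right'.measurable.div
    (h.measurable.comp (measurable_id.prodMk measurable_const))

/-- The statistic is the integrated likelihood ratio. -/
lemma IsGPLaw.stat_eq (hP : IsGPLaw P₀ 0 Sig) (hrank : ∀ θ, IsUnit (Sig (θ, θ₀)))
    {h : Path Θ k} (hh : h θ₀ = 0)
    (hpost : ∀ᵐ μ ∂(posteriorNuisance Sig θ₀ P₀ πθ πμ h), μ θ₀ = 0) {x : Vec k}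
    (hfin : intLikRatio Sig θ₀ P₀ πθ πμ h x ≠ ∞) :
    stat Sig θ₀ P₀ πθ πμ (h + psiPath Sig θ₀ x) =
      (intLikRatio Sig θ₀ P₀ πθ πμ h x).toReal := by
  have hu := hrank θ₀
  have hl := measurable_likRatio_shiftVec hrank
  have hg : (h + psiPath Sig θ₀ x) θ₀ = x := by
    rw [ContinuousMap.add_apply, hh, psiPath_self hu, zero_add]
  have hpos := normalDensity_pos (hP.det_pos hu) 0 x
  have hell (θ : Θ) : ellStar Sig θ₀ P₀ πθ πμ θ (h + psiPath Sig θ₀ x) =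
      normalDensity 0 (Sig (θ₀, θ₀)) x *
        (∫⁻ μ, ENNReal.ofReal (likRatio (Sig (θ₀, θ₀)) (shiftVec Sig θ₀ θ μ) x)
          ∂(posteriorNuisance Sig θ₀ P₀ πθ πμ h)).toReal := by
    have hm : Measurable fun μ => likRatio (Sig (θ₀, θ₀)) (shiftVec Sig θ₀ θ μ) x :=
      hl.comp (by fun_prop : Measurable fun μ : Path Θ k => ((θ, μ), x))
    rw [ellStar, hPart_hPart_add_psiPath hu hh, hg]
    simp_rw [hP.lik_eq]
    rw [integral_const_mul, integral_eq_lintegral_of_nonneg_ae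
      (ae_of_all _ fun μ => (likRatio_pos _ _ _).le) hm.aestronglyMeasurable]
  -- At θ₀ the mean of ξ is zero for posterior-almost every μ, so the denominator of T is just the
  -- N(0, Σ(θ₀, θ₀)) density.
  have hbase : ∫⁻ μ, ENNReal.ofReal (likRatio (Sig (θ₀, θ₀)) (shiftVec Sig θ₀ θ₀ μ) x)
      ∂(posteriorNuisance Sig θ₀ P₀ πθ πμ h) = 1 := by
    rw [lintegral_congr_ae (g := fun _ => 1), lintegral_one, measure_univ]
    filter_upwards [hpost] with μ hμ
    rw [shiftVec, hμ, map_zero, likRatio_zero, ENNReal.ofReal_one]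
  have hm : Measurable fun θ => ∫⁻ μ, ENNReal.ofReal
      (likRatio (Sig (θ₀, θ₀)) (shiftVec Sig θ₀ θ μ) x)
      ∂(posteriorNuisance Sig θ₀ P₀ πθ πμ h) := by
    refine Measurable.lintegral_prod_right' (f := fun p : Θ × Path Θ k =>
      ENNReal.ofReal (likRatio (Sig (θ₀, θ₀)) (shiftVec Sig θ₀ p.1 p.2) x)) ?_
    exact (hl.comp measurable_prodMk_right).ennreal_ofReal
  rw [stat, hell θ₀, hbase]
  simp_rw [hell]
  rw [integral_const_mul, integral_toReal hm.aemeasurable (ae_lt_top hm hfin), ENNReal.toReal_one,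
    mul_one, mul_div_cancel_left₀ _ hpos.ne', intLikRatio]

lemma measurable_critVal (μ₀ : Path Θ k) {α : ℝ} (hα₀ : 0 < α) (hα₁ : α < 1) :
    Measurable (critVal Sig θ₀ P₀ πθ πμ μ₀ α) := by
  unfold critVal
  have : IsProbabilityMeasure (gLaw Sig θ₀ P₀ θ₀ μ₀) :=
    Measure.isProbabilityMeasure_map (measurable_add_path _).aemeasurable
  have : IsMarkovKernel (condLawStat Sig θ₀ P₀ πθ πμ μ₀) := by
    unfold condLawStat; infer_instance
  exact measurable_quantile _ (by linarith) (by linarith)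

end Bayes

/-! ### Similarity and optimality of the test -/

section Optimality

variable {Θ : Type*} [MetricSpace Θ] [CompactSpace Θ] [MeasurableSpace Θ] [BorelSpace Θ] {k : ℕ}
  {Sig : CovFun Θ k} {θ₀ : Θ} {P₀ : Measure (Path Θ k)} [IsProbabilityMeasure P₀]
  {πθ : Measure Θ} [IsProbabilityMeasure πθ] {πμ : Measure (Path Θ k)} [IsProbabilityMeasure πμ]

lemma IsGPLaw.measurable_optTest (hP : IsGPLaw P₀ 0 Sig) (hrank : ∀ θ, IsUnit (Sig (θ, θ₀)))
    (μ₀ : Path Θ k) {α : ℝ} (hα₀ : 0 < α) (hα₁ : α < 1) :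
    Measurable (optTest Sig θ₀ P₀ πθ πμ μ₀ α) := by
  unfold optTest
  exact Measurable.ite (measurableSet_lt
    ((measurable_critVal μ₀ hα₀ hα₁).comp (measurable_hPart Sig θ₀)) (hP.measurable_stat hrank))
    measurable_const measurable_const

lemma optTest_mem_Icc (μ₀ : Path Θ k) (α : ℝ) (g : Path Θ k) :
    optTest Sig θ₀ P₀ πθ πμ μ₀ α g ∈ Icc (0 : ℝ) 1 := by
  unfold optTest
  split_ifs <;> simp

lemma ofReal_optTest (μ₀ : Path Θ k) (α : ℝ) (g : Path Θ k) :
    ENNReal.ofReal (optTest Sig θ₀ P₀ πθ πμ μ₀ α g) =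
      {g | critVal Sig θ₀ P₀ πθ πμ μ₀ α (hPart Sig θ₀ g) <
        stat Sig θ₀ P₀ πθ πμ g}.indicator (fun _ => 1) g := by
  by_cases hg : critVal Sig θ₀ P₀ πθ πμ μ₀ α (hPart Sig θ₀ g) < stat Sig θ₀ P₀ πθ πμ g
  · simp [optTest, hg]
  · simp [optTest, hg]

lemma hPart_add_of_apply_base_eq_zero {μ : Path Θ k} (hμ : μ θ₀ = 0) (g : Path Θ k) :
    hPart Sig θ₀ (g + μ) = hPart Sig θ₀ g + μ := by
  rw [hPart_add, hPart_eq_self _ _ hμ]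

/-- The conditional rejection probability of the optimal test is `α`. -/
lemma IsGPLaw.condNull_optTest_ae_eq (hP : IsGPLaw P₀ 0 Sig)
    (hrank : ∀ θ, IsUnit (Sig (θ, θ₀))) {α : ℝ} (hα₀ : 0 < α) (hα₁ : α < 1) {μ₀ : Path Θ k}
    (hμ₀ : μ₀ ∈ nuisanceSpace Sig θ₀)
    (hcont : ∀ᵐ h ∂((gLaw Sig θ₀ P₀ θ₀ μ₀).map (hPart Sig θ₀)),
      ∀ x : ℝ, condLawStat Sig θ₀ P₀ πθ πμ μ₀ h {x} = 0) :
    ∀ᵐ h ∂((gLaw Sig θ₀ P₀ θ₀ μ₀).map (hPart Sig θ₀)),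
      condNull Sig θ₀ P₀ (fun g => ENNReal.ofReal (optTest Sig θ₀ P₀ πθ πμ μ₀ α g)) h =
        ENNReal.ofReal α := by
  have hu := hrank θ₀
  have hbase := apply_base_of_mem_nuisanceSpace hu hμ₀
  have hh := measurable_hPart (k := k) Sig θ₀
  have hT : Measurable (stat Sig θ₀ P₀ πθ πμ) := hP.measurable_stat hrank
  have hc := measurable_critVal (Sig := Sig) (θ₀ := θ₀) (P₀ := P₀) (πθ := πθ) (πμ := πμ) μ₀ hα₀ hα₁
  have hF : Measurable fun g => ENNReal.ofReal (optTest Sig θ₀ P₀ πθ πμ μ₀ α g) :=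
    (hP.measurable_optTest hrank μ₀ hα₀ hα₁).ennreal_ofReal
  have hadd := measurable_add_path μ₀
  have hρ : gLaw Sig θ₀ P₀ θ₀ μ₀ = P₀.map fun g => g + μ₀ := gLaw_base hbase
  have : IsProbabilityMeasure (gLaw Sig θ₀ P₀ θ₀ μ₀) := by
    rw [hρ]; exact Measure.isProbabilityMeasure_map hadd.aemeasurable
  have : IsProbabilityMeasure ((gLaw Sig θ₀ P₀ θ₀ μ₀).map (hPart Sig θ₀)) :=
    Measure.isProbabilityMeasure_map hh.aemeasurable
  have : IsMarkovKernel (condLawStat Sig θ₀ P₀ πθ πμ μ₀) := by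
    unfold condLawStat; infer_instance
  -- The null integral of φ* over {h ∈ s} is computed twice: by integrating out the independent ξ,
  -- and through the conditional law of T given h, where the quantile gives α.
  refine ae_eq_of_forall_setLIntegral_eq_of_sigmaFinite (measurable_condNull hF) measurable_const
    fun s hs _ => ?_
  let A : Set (Path Θ k × ℝ) := {p | p.1 ∈ s ∧ critVal Sig θ₀ P₀ πθ πμ μ₀ α p.1 < p.2}
  have hA : MeasurableSet A :=
    (measurable_fst hs).inter (measurableSet_lt (hc.comp measurable_fst) measurable_snd)
  have hpair : Measurable fun g => (hPart Sig θ₀ g, stat Sig θ₀ P₀ πθ πμ g) := hh.prodMk hT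
  let F' : Path Θ k → ℝ≥0∞ := ((fun g => (hPart Sig θ₀ g, stat Sig θ₀ P₀ πθ πμ g)) ⁻¹' A).indicator
    1
  have hF' : Measurable F' := measurable_one.indicator (hpair hA)
  have hF'eq (g : Path Θ k) : F' g = s.indicator (fun _ => (1 : ℝ≥0∞)) (hPart Sig θ₀ g) *
      ENNReal.ofReal (optTest Sig θ₀ P₀ πθ πμ μ₀ α g) := by
    rw [ofReal_optTest]
    by_cases h1 : hPart Sig θ₀ g ∈ s <;>
    by_cases h2 : critVal Sig θ₀ P₀ πθ πμ μ₀ α (hPart Sig θ₀ g) < stat Sig θ₀ P₀ πθ πμ g <;>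
    simp [F', A, h1, h2]
  have lhs : ∫⁻ h in s, condNull Sig θ₀ P₀
      (fun g => ENNReal.ofReal (optTest Sig θ₀ P₀ πθ πμ μ₀ α g)) h
      ∂((gLaw Sig θ₀ P₀ θ₀ μ₀).map (hPart Sig θ₀)) = ∫⁻ g, F' g ∂(gLaw Sig θ₀ P₀ θ₀ μ₀) := by
    have hind : Measurable fun g => s.indicator (condNull Sig θ₀ P₀
        (fun g => ENNReal.ofReal (optTest Sig θ₀ P₀ πθ πμ μ₀ α g))) (hPart Sig θ₀ g) :=
      ((measurable_condNull hF).indicator hs).comp hh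
    rw [← lintegral_indicator hs, lintegral_map ((measurable_condNull hF).indicator hs) hh, hρ,
      lintegral_map hind hadd,
      lintegral_map hF' hadd, hP.lintegral_eq_condNull hu hF']
    refine lintegral_congr fun g => ?_
    have hz : (hPart Sig θ₀ g + μ₀) θ₀ = 0 := by
      rw [ContinuousMap.add_apply, hPart_self hu, hbase, add_zero]
    rw [hPart_add_of_apply_base_eq_zero hbase]
    simp only [condNull, hF'eq, hPart_hPart_add_psiPath hu hz]
    by_cases h1 : hPart Sig θ₀ g + μ₀ ∈ s <;> simp [h1, condNull]
  have rhs : ∫⁻ g, F' g ∂(gLaw Sig θ₀ P₀ θ₀ μ₀) = ∫⁻ _ in s, ENNReal.ofReal α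
      ∂((gLaw Sig θ₀ P₀ θ₀ μ₀).map (hPart Sig θ₀)) := by
    rw [lintegral_indicator_one (hpair hA), ← Measure.map_apply hpair hA,
      ← compProd_map_condDistrib hT.aemeasurable, Measure.compProd_apply hA,
      ← lintegral_indicator hs]
    refine lintegral_congr_ae ?_
    filter_upwards [hcont] with h hcont
    by_cases h1 : h ∈ s
    · have hAs : Prod.mk h ⁻¹' A = Ioi (critVal Sig θ₀ P₀ πθ πμ μ₀ α h) := by
        ext t
        simp [A, h1]
      have := measure_Ioi_quantile (ν := condLawStat Sig θ₀ P₀ πθ πμ μ₀ h) (q := 1 - α)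
        (by linarith) (by linarith) hcont
      rw [hAs, indicator_of_mem h1, ← condLawStat, critVal, this, sub_sub_cancel]
    · have hAs : Prod.mk h ⁻¹' A = ∅ := by
        ext t
        simp [A, h1]
      rw [hAs, indicator_of_notMem h1, measure_empty]
  rw [lhs, rhs]

lemma integral_eq_toReal_lintegral {Ω : Type*} {mΩ : MeasurableSpace Ω} {P : Measure Ω}
    {φ : Ω → ℝ} (hφ : Measurable φ) (h0 : ∀ g, 0 ≤ φ g) :
    ∫ g, φ g ∂P = (∫⁻ g, ENNReal.ofReal (φ g) ∂P).toReal :=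
  integral_eq_lintegral_of_nonneg_ae (ae_of_all _ h0) hφ.aestronglyMeasurable

/-- The optimal test is similar. -/
theorem IsGPLaw.isSimilarTest_optTest (hP : IsGPLaw P₀ 0 Sig)
    (hrank : ∀ θ, IsUnit (Sig (θ, θ₀))) {α : ℝ} (hα₀ : 0 < α) (hα₁ : α < 1) {μ₀ : Path Θ k}
    (hμ₀ : μ₀ ∈ nuisanceSpace Sig θ₀)
    (hcont : ∀ᵐ h ∂((gLaw Sig θ₀ P₀ θ₀ μ₀).map (hPart Sig θ₀)),
      ∀ x : ℝ, condLawStat Sig θ₀ P₀ πθ πμ μ₀ h {x} = 0) :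
    IsSimilarTest Sig θ₀ P₀ α (optTest Sig θ₀ P₀ πθ πμ μ₀ α) := by
  have hu := hrank θ₀
  have hm := hP.measurable_optTest (πθ := πθ) (πμ := πμ) hrank μ₀ hα₀ hα₁
  refine ⟨hm, optTest_mem_Icc μ₀ α, fun μ hμ => ?_⟩
  have hbase := apply_base_of_mem_nuisanceSpace hu hμ
  have hbase₀ := apply_base_of_mem_nuisanceSpace hu hμ₀
  have hh := measurable_hPart (k := k) Sig θ₀
  have h1 := hP.condNull_optTest_ae_eq hrank hα₀ hα₁ hμ₀ hcont
  rw [gLaw_base hbase₀] at h1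
  -- Exceptional null sets at μ₀ are also null at μ, by absolute continuity of the shifted laws.
  have h2 := ae_of_ae_map (measurable_add_path μ).aemeasurable
    ((hP.map_add_absolutelyContinuous hu hμ hμ₀).ae_le (ae_of_ae_map hh.aemeasurable h1))
  rw [integral_eq_toReal_lintegral hm fun g => (optTest_mem_Icc μ₀ α g).1, gLaw_base hbase,
    lintegral_map hm.ennreal_ofReal (measurable_add_path μ),
    hP.lintegral_eq_condNull hu hm.ennreal_ofReal,
    lintegral_congr_ae (g := fun _ => ENNReal.ofReal α)]
  · simp [hα₀.le]
  · filter_upwards [h2] with g hg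
    rwa [hPart_add_of_apply_base_eq_zero hbase] at hg

/-- The prior law of h is a mixture over μ of its laws under (θ₀, μ), and the conditional size is α
almost surely under each. -/
lemma IsSimilarTest.condNull_ae_hLaw (hP : IsGPLaw P₀ 0 Sig) (h : IsUnit (Sig (θ₀, θ₀)))
    (hπμ : ∀ᵐ μ ∂πμ, μ ∈ nuisanceSpace Sig θ₀) {α : ℝ} {φ : Path Θ k → ℝ}
    (hφ : IsSimilarTest Sig θ₀ P₀ α φ) :
    ∀ᵐ h ∂(hLaw Sig θ₀ P₀ πμ), condNull Sig θ₀ P₀ (fun g => ENNReal.ofReal (φ g)) h =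
      ENNReal.ofReal α := by
  have hF := measurable_condNull (Sig := Sig) (θ₀ := θ₀) (P₀ := P₀) hφ.measurable.ennreal_ofReal
  have hset : MeasurableSet {h | condNull Sig θ₀ P₀ (fun g => ENNReal.ofReal (φ g)) h =
      ENNReal.ofReal α} := hF (measurableSet_singleton _)
  rw [hLaw, ae_map_iff measurable_hPart_add.aemeasurable hset]
  refine (Measure.ae_prod_iff_ae_ae (measurable_hPart_add hset)).2 ?_
  filter_upwards [hπμ] with μ hμ
  filter_upwards [hφ.condNull_ae_eq hP h hμ] with g hg
  rwa [hPart_add_of_apply_base_eq_zero (apply_base_of_mem_nuisanceSpace h hμ)]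

/-- The prior gives μ(θ₀) = 0 almost surely, and the disintegration passes this to almost every
posterior. These are the side conditions of `IsGPLaw.stat_eq`. -/
lemma ae_hLaw_base (hrank : ∀ θ, IsUnit (Sig (θ, θ₀)))
    (hπμ : ∀ᵐ μ ∂πμ, μ ∈ nuisanceSpace Sig θ₀) :
    ∀ᵐ h ∂(hLaw Sig θ₀ P₀ πμ), h θ₀ = 0 ∧
      ∀ᵐ μ ∂(posteriorNuisance Sig θ₀ P₀ πθ πμ h), μ θ₀ = 0 := by
  have hu := hrank θ₀
  have hev : Measurable fun g : Path Θ k => g θ₀ := (continuous_eval_const θ₀).measurable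
  have h1 : ∀ᵐ h ∂(hLaw Sig θ₀ P₀ πμ), h θ₀ = 0 := by
    exact (ae_map_iff measurable_hPart_add.aemeasurable (hev (measurableSet_singleton _))).2
      (ae_of_all _ fun p => hPart_self hu _)
  have h2 : ∀ᵐ p ∂(hLaw Sig θ₀ P₀ πμ ⊗ₘ posteriorNuisance Sig θ₀ P₀ πθ πμ), p.2 θ₀ = 0 := by
    have hset : MeasurableSet {p : Path Θ k × Path Θ k | p.2 θ₀ = 0} :=
      (hev.comp measurable_snd) (measurableSet_singleton _)
    have hset' : MeasurableSet {p : Path Θ k × Path Θ k | p.1 θ₀ = 0} :=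
      (hev.comp measurable_fst) (measurableSet_singleton _)
    rw [hLaw_compProd_posterior hrank, nuisanceJoint,
      ae_map_iff (measurable_hPart_add.prodMk measurable_fst).aemeasurable hset]
    refine (Measure.ae_prod_iff_ae_ae hset').2 ?_
    filter_upwards [hπμ] with μ hμ
    exact ae_of_all _ fun g => apply_base_of_mem_nuisanceSpace hu hμ
  filter_upwards [h1, Measure.ae_ae_of_ae_compProd h2] with h h1 h2
  exact ⟨h1, h2⟩

lemma lintegral_gLaw_le_one (θ : Θ) (μ : Path Θ k) {φ : Path Θ k → ℝ}
    (hφ : ∀ g, φ g ∈ Icc (0 : ℝ) 1) :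
    ∫⁻ g, ENNReal.ofReal (φ g) ∂(gLaw Sig θ₀ P₀ θ μ) ≤ 1 := by
  have : IsProbabilityMeasure (gLaw Sig θ₀ P₀ θ μ) :=
    Measure.isProbabilityMeasure_map (measurable_add_path _).aemeasurable
  exact (lintegral_mono (g := fun _ => 1) fun g => ENNReal.ofReal_le_one.2 (hφ g).2).trans
    (by simp)

/-- The optimal test maximizes weighted average power among similar tests. -/
theorem IsGPLaw.lintegral_power_le (hP : IsGPLaw P₀ 0 Sig)
    (hrank : ∀ θ, IsUnit (Sig (θ, θ₀))) (hπμ : ∀ᵐ μ ∂πμ, μ ∈ nuisanceSpace Sig θ₀)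
    {α : ℝ} {μ₀ : Path Θ k}
    (hopt : IsSimilarTest Sig θ₀ P₀ α (optTest Sig θ₀ P₀ πθ πμ μ₀ α)) {φ : Path Θ k → ℝ}
    (hφ : IsSimilarTest Sig θ₀ P₀ α φ) :
    ∫⁻ p, ∫⁻ g, ENNReal.ofReal (φ g) ∂(gLaw Sig θ₀ P₀ p.1 p.2) ∂(πθ.prod πμ) ≤
      ∫⁻ p, ∫⁻ g, ENNReal.ofReal (optTest Sig θ₀ P₀ πθ πμ μ₀ α g) ∂(gLaw Sig θ₀ P₀ p.1 p.2)
        ∂(πθ.prod πμ) := by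
  have hu := hrank θ₀
  have hW := measurable_intLikRatio (P₀ := P₀) (πθ := πθ) (πμ := πμ) hrank
  have hψ := (continuous_psiPath Sig θ₀).measurable
  have hWfin : ∀ᵐ h ∂(hLaw Sig θ₀ P₀ πμ), ∀ᵐ x ∂(P₀.map fun g => g θ₀),
      intLikRatio Sig θ₀ P₀ πθ πμ h x < ∞ := by
    -- The constant test 1 has average power 1, so W has total integral 1 and is finite almost
    -- everywhere.
    have hone := hP.lintegral_gLaw_eq (πθ := πθ) hrank hπμ (φ := fun _ => 1) measurable_const
    have hprob (p : Θ × Path Θ k) : IsProbabilityMeasure (gLaw Sig θ₀ P₀ p.1 p.2) :=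
      Measure.isProbabilityMeasure_map (measurable_add_path _).aemeasurable
    simp only [lintegral_one, measure_univ, one_mul] at hone
    filter_upwards [ae_lt_top (hW.lintegral_prod_right' (ν := P₀.map fun g => g θ₀))
      (hone ▸ ENNReal.one_ne_top)] with h hh
    exact ae_lt_top (hW.comp measurable_prodMk_left) hh.ne
  rw [hP.lintegral_gLaw_eq hrank hπμ hφ.measurable.ennreal_ofReal,
    hP.lintegral_gLaw_eq hrank hπμ hopt.measurable.ennreal_ofReal]
  refine lintegral_mono_ae ?_
  filter_upwards [hWfin, ae_hLaw_base (πθ := πθ) (P₀ := P₀) hrank hπμ,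
    hφ.condNull_ae_hLaw hP hu hπμ, hopt.condNull_ae_hLaw hP hu hπμ]
    with h hWfin hbase hφα hoptα
  set c := critVal Sig θ₀ P₀ πθ πμ μ₀ α h
  have hadd : Measurable fun x => h + psiPath Sig θ₀ x := by fun_prop
  have hWx : Measurable fun x => intLikRatio Sig θ₀ P₀ πθ πμ h x := hW.comp measurable_prodMk_left
  have hφm : Measurable fun x => ENNReal.ofReal (φ (h + psiPath Sig θ₀ x)) :=
    (hφ.measurable.comp hadd).ennreal_ofReal
  have hoptm : Measurable fun x =>
      ENNReal.ofReal (optTest Sig θ₀ P₀ πθ πμ μ₀ α (h + psiPath Sig θ₀ x)) :=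
    (hopt.measurable.comp hadd).ennreal_ofReal
  -- This is the Neyman–Pearson inequality (φ* - φ)(W - c) ≥ 0, rearranged into sums because
  -- subtraction in `ℝ≥0∞` truncates. A negative c is replaced by 0, which is harmless as W ≥ 0.
  have hle : ∫⁻ x, (ENNReal.ofReal (φ (h + psiPath Sig θ₀ x)) * intLikRatio Sig θ₀ P₀ πθ πμ h x +
        ENNReal.ofReal (optTest Sig θ₀ P₀ πθ πμ μ₀ α (h + psiPath Sig θ₀ x)) * ENNReal.ofReal c)
        ∂(P₀.map fun g => g θ₀) ≤
      ∫⁻ x, (ENNReal.ofReal (optTest Sig θ₀ P₀ πθ πμ μ₀ α (h + psiPath Sig θ₀ x)) *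
        intLikRatio Sig θ₀ P₀ πθ πμ h x +
        ENNReal.ofReal (φ (h + psiPath Sig θ₀ x)) * ENNReal.ofReal c)
        ∂(P₀.map fun g => g θ₀) := by
    refine lintegral_mono_ae ?_
    filter_upwards [hWfin] with x hx
    have hs := hP.stat_eq hrank hbase.1 hbase.2 hx.ne
    have hhp := hPart_hPart_add_psiPath hu hbase.1 x
    have hφ1 : ENNReal.ofReal (φ (h + psiPath Sig θ₀ x)) ≤ 1 :=
      ENNReal.ofReal_le_one.2 (hφ.mem_Icc _).2
    rw [ofReal_optTest]
    by_cases hlt : c < (intLikRatio Sig θ₀ P₀ πθ πμ h x).toReal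
    · have hcW : ENNReal.ofReal c ≤ intLikRatio Sig θ₀ P₀ πθ πμ h x :=
        ENNReal.ofReal_le_of_le_toReal hlt.le
      rw [indicator_of_mem (by rw [mem_ofPred_eq, hs, hhp]; exact hlt), one_mul, one_mul]
      obtain ⟨d, hd⟩ := exists_add_of_le hcW
      obtain ⟨e, he⟩ := exists_add_of_le hφ1
      rw [hd]
      calc ENNReal.ofReal (φ (h + psiPath Sig θ₀ x)) * (ENNReal.ofReal c + d) + ENNReal.ofReal c
          = ENNReal.ofReal (φ (h + psiPath Sig θ₀ x)) * d + (ENNReal.ofReal c +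
            ENNReal.ofReal (φ (h + psiPath Sig θ₀ x)) * ENNReal.ofReal c) := by ring
        _ ≤ 1 * d + (ENNReal.ofReal c +
            ENNReal.ofReal (φ (h + psiPath Sig θ₀ x)) * ENNReal.ofReal c) := by gcongr
        _ = _ := by ring
    · rw [indicator_of_notMem (by rw [mem_ofPred_eq, hs, hhp]; exact hlt), zero_mul, zero_mul,
        zero_add, add_zero]
      gcongr
      exact ENNReal.le_ofReal_iff_toReal_le hx.ne
        (ENNReal.toReal_nonneg.trans (not_lt.1 hlt)) |>.2 (not_lt.1 hlt)
  have hφW : Measurable fun x => ENNReal.ofReal (φ (h + psiPath Sig θ₀ x)) *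
      intLikRatio Sig θ₀ P₀ πθ πμ h x := hφm.mul hWx
  have hoptW : Measurable fun x =>
      ENNReal.ofReal (optTest Sig θ₀ P₀ πθ πμ μ₀ α (h + psiPath Sig θ₀ x)) *
        intLikRatio Sig θ₀ P₀ πθ πμ h x := hoptm.mul hWx
  rw [lintegral_add_left hφW, lintegral_add_left hoptW,
    lintegral_mul_const _ hφm, lintegral_mul_const _ hoptm] at hle
  -- Both tests have conditional size α, so the two terms carrying c are equal and finite, and they
  -- cancel.
  simp only [condNull] at hφα hoptα
  rw [hφα, hoptα] at hle
  exact (ENNReal.add_le_add_iff_right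
    (ENNReal.mul_ne_top ENNReal.ofReal_ne_top ENNReal.ofReal_ne_top)).1 hle

/-- Power is bounded by 1, and it is measurable because the mean function is jointly continuous in
(θ, μ). -/
lemma integrable_power (hrank : ∀ θ, IsUnit (Sig (θ, θ₀))) {φ : Path Θ k → ℝ}
    (hφ : Measurable φ) (hφI : ∀ g, φ g ∈ Icc (0 : ℝ) 1) :
    Integrable (fun p : Θ × Path Θ k => ∫ g, φ g ∂(gLaw Sig θ₀ P₀ p.1 p.2)) (πθ.prod πμ) ∧
      ∫ p, ∫ g, φ g ∂(gLaw Sig θ₀ P₀ p.1 p.2) ∂(πθ.prod πμ) =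
        (∫⁻ p, ∫⁻ g, ENNReal.ofReal (φ g) ∂(gLaw Sig θ₀ P₀ p.1 p.2) ∂(πθ.prod πμ)).toReal := by
  have hpower : Measurable fun p : Θ × Path Θ k =>
      ∫⁻ g, ENNReal.ofReal (φ g) ∂(gLaw Sig θ₀ P₀ p.1 p.2) := by
    have e : ∀ p : Θ × Path Θ k, ∫⁻ g, ENNReal.ofReal (φ g) ∂(gLaw Sig θ₀ P₀ p.1 p.2) =
        ∫⁻ g, ENNReal.ofReal (φ (g + meanFun Sig θ₀ p.1 p.2)) ∂P₀ := fun p => by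
      rw [gLaw, lintegral_map hφ.ennreal_ofReal (measurable_add_path _)]
    simp_rw [e]
    exact (hφ.ennreal_ofReal.comp (measurable_add_meanFun hrank)).lintegral_prod_right'
  have hle (p : Θ × Path Θ k) :=
    lintegral_gLaw_le_one (Sig := Sig) (θ₀ := θ₀) (P₀ := P₀) p.1 p.2 hφI
  simp_rw [fun p : Θ × Path Θ k => integral_eq_toReal_lintegral (P := gLaw Sig θ₀ P₀ p.1 p.2) hφ
    fun g => (hφI g).1]
  refine ⟨Integrable.of_bound (C := 1) hpower.ennreal_toReal.aestronglyMeasurable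
    (ae_of_all _ fun p => ?_), ?_⟩
  · rw [Real.norm_of_nonneg ENNReal.toReal_nonneg]
    exact ENNReal.toReal_le_of_le_ofReal zero_le_one (by simpa using hle p)
  · exact integral_toReal hpower.aemeasurable
      (ae_of_all _ fun p => (hle p).trans_lt ENNReal.one_lt_top)

/-- Comparison of weighted average power, from Lebesgue to Bochner integrals. -/
lemma integral_power_sub_nonneg (hrank : ∀ θ, IsUnit (Sig (θ, θ₀))) {φ₁ φ₂ : Path Θ k → ℝ}
    (hφ₁ : Measurable φ₁) (hI₁ : ∀ g, φ₁ g ∈ Icc (0 : ℝ) 1)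
    (hφ₂ : Measurable φ₂) (hI₂ : ∀ g, φ₂ g ∈ Icc (0 : ℝ) 1)
    (hle : ∫⁻ p, ∫⁻ g, ENNReal.ofReal (φ₂ g) ∂(gLaw Sig θ₀ P₀ p.1 p.2) ∂(πθ.prod πμ) ≤
      ∫⁻ p, ∫⁻ g, ENNReal.ofReal (φ₁ g) ∂(gLaw Sig θ₀ P₀ p.1 p.2) ∂(πθ.prod πμ)) :
    Integrable (fun p : Θ × Path Θ k => ∫ g, (φ₁ g - φ₂ g) ∂(gLaw Sig θ₀ P₀ p.1 p.2))
        (πθ.prod πμ) ∧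
      0 ≤ ∫ p, (∫ g, (φ₁ g - φ₂ g) ∂(gLaw Sig θ₀ P₀ p.1 p.2)) ∂(πθ.prod πμ) := by
  obtain ⟨h1, e1⟩ := integrable_power (P₀ := P₀) (πθ := πθ) (πμ := πμ) hrank hφ₁ hI₁
  obtain ⟨h2, e2⟩ := integrable_power (P₀ := P₀) (πθ := πθ) (πμ := πμ) hrank hφ₂ hI₂
  have hsub : (fun p : Θ × Path Θ k => ∫ g, (φ₁ g - φ₂ g) ∂(gLaw Sig θ₀ P₀ p.1 p.2)) =
      fun p => ∫ g, φ₁ g ∂(gLaw Sig θ₀ P₀ p.1 p.2) - ∫ g, φ₂ g ∂(gLaw Sig θ₀ P₀ p.1 p.2) :=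
    funext fun p => integral_sub
      (Integrable.of_mem_Icc 0 1 hφ₁.aemeasurable (ae_of_all _ hI₁))
      (Integrable.of_mem_Icc 0 1 hφ₂.aemeasurable (ae_of_all _ hI₂))
  have key {A B : Θ × Path Θ k → ℝ} (hA : Integrable A (πθ.prod πμ))
      (hB : Integrable B (πθ.prod πμ)) (hAB : ∫ p, B p ∂(πθ.prod πμ) ≤ ∫ p, A p ∂(πθ.prod πμ)) :
      Integrable (fun p => A p - B p) (πθ.prod πμ) ∧ 0 ≤ ∫ p, (A p - B p) ∂(πθ.prod πμ) :=
    ⟨hA.sub hB, by rw [integral_sub hA hB]; linarith⟩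
  rw [hsub]
  refine key h1 h2 ?_
  rw [e1, e2]
  refine ENNReal.toReal_mono ?_ hle
  have hle_one (p : Θ × Path Θ k) : ∫⁻ g, ENNReal.ofReal (φ₁ g) ∂(gLaw Sig θ₀ P₀ p.1 p.2) ≤ 1 :=
    lintegral_gLaw_le_one p.1 p.2 hI₁
  have hone : ∫⁻ _ : Θ × Path Θ k, (1 : ℝ≥0∞) ∂(πθ.prod πμ) = 1 := by
    rw [lintegral_one, measure_univ]
  exact ne_top_of_le_ne_top ENNReal.one_ne_top ((lintegral_mono hle_one).trans_eq hone)

end Optimality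

end WeakGMM

end

theorem theorem4 {Θ : Type*} [MetricSpace Θ] [CompactSpace Θ] [MeasurableSpace Θ] [BorelSpace Θ]
    {k : ℕ} (Sig : WeakGMM.CovFun Θ k)
    (P₀ : Measure (WeakGMM.Path Θ k)) [IsProbabilityMeasure P₀] (hP₀ : WeakGMM.IsGPLaw P₀ 0 Sig)
    (θ₀ : Θ) (hrank : ∀ θ : Θ, IsUnit (Sig (θ, θ₀)))
    (πθ : Measure Θ) [IsProbabilityMeasure πθ]
    (πμ : Measure (WeakGMM.Path Θ k)) [IsProbabilityMeasure πμ]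
    (hπμ : ∀ᵐ μ ∂πμ, μ ∈ WeakGMM.nuisanceSpace Sig θ₀)
    (α : ℝ) (hα₀ : 0 < α) (hα₁ : α < 1)
    (μ₀ : WeakGMM.Path Θ k) (hμ₀ : μ₀ ∈ WeakGMM.nuisanceSpace Sig θ₀)
    (hcont : ∀ᵐ h ∂((WeakGMM.gLaw Sig θ₀ P₀ θ₀ μ₀).map (WeakGMM.hPart Sig θ₀)),
      ∀ x : ℝ, WeakGMM.condLawStat Sig θ₀ P₀ πθ πμ μ₀ h {x} = 0) :
    WeakGMM.IsSimilarTest Sig θ₀ P₀ α (WeakGMM.optTest Sig θ₀ P₀ πθ πμ μ₀ α) ∧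
    ∀ φ : WeakGMM.Path Θ k → ℝ, WeakGMM.IsSimilarTest Sig θ₀ P₀ α φ →
      Integrable (fun p : Θ × WeakGMM.Path Θ k =>
        ∫ g, (WeakGMM.optTest Sig θ₀ P₀ πθ πμ μ₀ α g - φ g) ∂(WeakGMM.gLaw Sig θ₀ P₀ p.1 p.2))
        (πθ.prod πμ) ∧
      0 ≤ ∫ p, (∫ g, (WeakGMM.optTest Sig θ₀ P₀ πθ πμ μ₀ α g - φ g)
        ∂(WeakGMM.gLaw Sig θ₀ P₀ p.1 p.2)) ∂(πθ.prod πμ) := by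
  have hopt := hP₀.isSimilarTest_optTest (πθ := πθ) (πμ := πμ) hrank hα₀ hα₁ hμ₀ hcont
  refine ⟨hopt, fun φ hφ => ?_⟩
  exact WeakGMM.integral_power_sub_nonneg hrank hopt.measurable hopt.mem_Icc hφ.measurable
    hφ.mem_Icc (hP₀.lintegral_power_le hrank hπμ hopt hφ)
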